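/- Theorem 1.2. Let $L>0$ and let $u:[0,L]\to\mathbb{R}$ be continuously differentiable (with one-sided derivatives at the end points), with $u'(0)=u'(L)=0$ and $\int_0^L u(s)\,ds=0$. Then $$\int_0^L u(s)^4\,ds\;\le\; C_0\,L\left(\int_0^L u(s)^2\,ds\right)\left(\int_0^L u'(s)^2\,ds\right)\qquad\text{with } C_0=0.162278 .$$ Moreover, the optimal constant is $0.1622778\ldots$: there is a number $C_{\mathrm{opt}}$ with $0.1622778<C_{\mathrm{opt}}<0.1622779$ such that, for every $L>0$ and every $n\in\{1,2,\dots,\infty\}$, $C_{\mathrm{opt}}$ is the smallest constant $C\in\mathbb{R}$ for which $$\int_0^L u(s)^4\,ds\le C\,L\left(\int_0^L u(s)^2\,ds\right)\left(\int_0^L u'(s)^2\,ds\right)$$ holds for all $u\in C^n([0,L])$ with $u'(0)=u'(L)=0$ and $\int_0^L u(s)\,ds=0$. -/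

import Mathlib

open Set

/-- Functions `u : [0, L] → ℝ` of class `C^n` (`1 ≤ n ≤ ∞`), with mean value zero and
`u'(0) = u'(L) = 0`. Derivatives are taken within `[0, L]`, hence one-sided at the end points;
values of `u` outside `[0, L]` are irrelevant. -/
structure IsNeumannMeanZero (n : ℕ∞) (L : ℝ) (u : ℝ → ℝ) : Prop where
  contDiffOn : ContDiffOn ℝ n u (Icc 0 L)
  deriv_left : derivWithin u (Icc 0 L) 0 = 0
  deriv_right : derivWithin u (Icc 0 L) L = 0
  mean_zero : ∫ s in (0 : ℝ)..L, u s = 0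

/-- The inequality `∫₀ᴸ u⁴ ≤ C L (∫₀ᴸ u²) (∫₀ᴸ (u')²)`. -/
def InterpolationIneq (C L : ℝ) (u : ℝ → ℝ) : Prop :=
  ∫ s in (0 : ℝ)..L, u s ^ 4 ≤
    C * L * (∫ s in (0 : ℝ)..L, u s ^ 2) *
      ∫ s in (0 : ℝ)..L, derivWithin u (Icc 0 L) s ^ 2

/-!
The optimal constant is bracketed by a trial function from below and by a calibration from above.
The set of admissible constants depends neither on the length, by dilation, nor on the smoothness,
because `u'` is a uniform limit of polynomials vanishing at the end points
(`interpolationIneq_of_smooth`). So everything happens on `[0, 1]` with `u` of class `C¹`, the set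
of admissible constants is closed, and its infimum is the optimal constant.

For the upper bound let `u` have mean zero and, after scaling and a change of sign, range
`[c - 1, c + 1]` with `0 ≤ c ≤ 1`. Put `t² = ∫ u²`. Young's inequality gives
`K² u'² + w(u)² ≥ 2 K w(u) u'`, and integrating between a minimum and a maximum point of `u`
gives `K² ∫ u'² + ∫ w(u)² ≥ 2 K ∫ w`, the last integral being over the range. If
`w(y)² ≤ -y⁴ + κ y² + l y + ν` there, this is a lower bound
for `K² ∫ u'² - ∫ u⁴` (`quartic_calibration`), and `K = 0.4028373 t` yields the inequality with
constant `0.4028373²`, which lies between the optimal constant and `0.1622779`, provided that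
`κ t² + ν ≤ 2 K ∫ w`. It remains to find `κ`, `l`, `ν`, `w` for all pairs `(c, t)` with
`t² ≤ 1 - c²`, the bound for the variance in terms of the extreme values.

* If `t ≤ 0.466`, then `w(y) = |y| √((1 + c)² - y²)` does it (`interpolation_of_small_mass`).
* Otherwise take the quartic `(1 - z²)(z² + 4cz + r)`, with `z = y - c`, and
  `w = √(1 - z²) (S(z²) + 2cz / S(z²))`, where `S > 0` has to satisfy `S² + 4c²s / S² ≤ s + r` for
  `0 ≤ s ≤ 1`. The integral of `w` is that of `√(1 - z²) S(z²)` (`profile_calibration`). For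
  `c ≥ 1/2` a constant `S` suffices (`exists_const_profile`).
* For `c ≤ 1/2` the function `S` is `profile r (c²)`, which is concave in `c²`. For fixed `r` the
  inequality is then, up to a small correction, concave in `c²` and in `t` separately, so that on a
  rectangle it has to be checked at the corners only (`Cell.Valid.profile_bound`). Sixteen
  rectangles cover the parameters (`exists_base_profile`).

At the corners the elliptic integrals `∫ √(1 - z²) S(z²)` are bounded below by integrals of
polynomials: `X Y (3 - X Y²) / 2 ≤ √X` for every `Y ≥ 0`, with an error quadratic in that of the
approximation `Y` of `1 / √X`, so that only the sign of `Y` has to be known.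
-/

/-! ### Calibrations -/

/-- For `x ≤ y`, integrating `2 K w(u) u' ≤ K² u'² + w(u)²` over `[x, y]` and changing variables
on the left gives an inequality whose left side only sees the values of `u` at `x` and `y`. -/
theorem calibration_of_le {u w : ℝ → ℝ} {a b x y K : ℝ} (hu : ContDiffOn ℝ 1 u (Icc 0 1))
    (hmaps : MapsTo u (Icc 0 1) (Icc a b)) (hw : ContinuousOn w (Icc a b))
    (hx : 0 ≤ x) (hxy : x ≤ y) (hy : y ≤ 1) :
    2 * K * ∫ s in u x..u y, w s ≤
      K ^ 2 * (∫ s in (0 : ℝ)..1, derivWithin u (Icc 0 1) s ^ 2) +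
        ∫ s in (0 : ℝ)..1, w (u s) ^ 2 := by
  have hsub : Icc x y ⊆ Icc (0 : ℝ) 1 := Icc_subset_Icc hx hy
  have hdc : ContinuousOn (derivWithin u (Icc 0 1)) (Icc 0 1) :=
    hu.continuousOn_derivWithin (uniqueDiffOn_Icc one_pos) le_rfl
  have hwu : ContinuousOn (fun s => w (u s)) (Icc 0 1) := hw.comp hu.continuousOn hmaps
  have hmaps' : u '' Icc x y ⊆ Icc a b := by
    rintro _ ⟨s, hs, rfl⟩
    exact hmaps (hsub hs)
  have key : ∫ s in x..y, (w ∘ u) s * derivWithin u (Icc 0 1) s = ∫ s in u x..u y, w s := by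
    apply intervalIntegral.integral_comp_mul_deriv'''
    · rw [uIcc_of_le hxy]; exact hu.continuousOn.mono hsub
    · intro s hs
      rw [min_eq_left hxy, max_eq_right hxy] at hs
      have hs' : s ∈ Ioo (0 : ℝ) 1 := ⟨hx.trans_lt hs.1, hs.2.trans_le hy⟩
      have h1 := ((hu.differentiableOn one_ne_zero) s (Ioo_subset_Icc_self hs')).hasDerivWithinAt
      exact (h1.hasDerivAt (Icc_mem_nhds hs'.1 hs'.2)).hasDerivWithinAt
    · rw [min_eq_left hxy, max_eq_right hxy]
      exact hw.mono ((image_mono Ioo_subset_Icc_self).trans hmaps')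
    · rw [uIcc_of_le hxy]
      exact (hw.integrableOn_Icc).mono_set hmaps'
    · rw [uIcc_of_le hxy]
      exact ((hwu.mono hsub).mul (hdc.mono hsub)).integrableOn_Icc
  have hD : ContinuousOn (fun s => K ^ 2 * derivWithin u (Icc 0 1) s ^ 2 + w (u s) ^ 2)
      (Icc 0 1) := (continuousOn_const.mul (hdc.pow 2)).add (hwu.pow 2)
  have hint : ∀ f : ℝ → ℝ, ContinuousOn f (Icc 0 1) →
      IntervalIntegrable f MeasureTheory.volume 0 1 := fun f hf =>
    (hf.mono (by rw [uIcc_of_le zero_le_one])).intervalIntegrable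
  calc 2 * K * ∫ s in u x..u y, w s
      = ∫ s in x..y, 2 * K * ((w ∘ u) s * derivWithin u (Icc 0 1) s) := by
        rw [← key, intervalIntegral.integral_const_mul]
    _ ≤ ∫ s in x..y, (K ^ 2 * derivWithin u (Icc 0 1) s ^ 2 + w (u s) ^ 2) := by
        apply intervalIntegral.integral_mono_on hxy
        · refine ContinuousOn.intervalIntegrable ?_
          rw [uIcc_of_le hxy]
          exact continuousOn_const.mul ((hwu.mono hsub).mul (hdc.mono hsub))
        · refine ContinuousOn.intervalIntegrable ?_
          rw [uIcc_of_le hxy]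
          exact hD.mono hsub
        · intro s _
          simp only [Function.comp]
          nlinarith [sq_nonneg (K * derivWithin u (Icc 0 1) s - w (u s))]
    _ ≤ ∫ s in (0 : ℝ)..1, (K ^ 2 * derivWithin u (Icc 0 1) s ^ 2 + w (u s) ^ 2) := by
        apply intervalIntegral.integral_mono_interval hx hxy hy
        · exact Filter.Eventually.of_forall fun s => by positivity
        · exact hint _ hD
    _ = _ := by
        rw [intervalIntegral.integral_add, intervalIntegral.integral_const_mul]
        · exact hint _ (continuousOn_const.mul (hdc.pow 2))
        · exact hint _ (hwu.pow 2)

/-- The energy `K² ∫ u'² + ∫ w(u)²` is at least `2 K ∫ w` over the range of `u`; no order between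
the points `x` and `y` is required, since the sign of `K` is free. -/
theorem calibration {u w : ℝ → ℝ} {a b x y K : ℝ} (hu : ContDiffOn ℝ 1 u (Icc 0 1))
    (hmaps : MapsTo u (Icc 0 1) (Icc a b)) (hw : ContinuousOn w (Icc a b))
    (hx : x ∈ Icc (0 : ℝ) 1) (hy : y ∈ Icc (0 : ℝ) 1) :
    2 * K * ∫ s in u x..u y, w s ≤
      K ^ 2 * (∫ s in (0 : ℝ)..1, derivWithin u (Icc 0 1) s ^ 2) +
        ∫ s in (0 : ℝ)..1, w (u s) ^ 2 := by
  rcases le_total x y with h | h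
  · exact calibration_of_le hu hmaps hw hx.1 h hy.2
  · have := calibration_of_le (K := -K) hu hmaps hw hy.1 h hx.2
    rw [intervalIntegral.integral_symm (u y) (u x)]
    rw [neg_sq] at this
    linarith

/-- The calibration inequality with a weight `w` whose square is dominated by a quartic polynomial
with leading term `-z⁴` and no cubic term. The linear term does not contribute, as `u` has mean
zero. -/
theorem quartic_calibration {u w : ℝ → ℝ} {a b x y K κ l ν : ℝ}
    (hu : ContDiffOn ℝ 1 u (Icc 0 1)) (hmean : ∫ s in (0 : ℝ)..1, u s = 0)
    (hmaps : MapsTo u (Icc 0 1) (Icc a b)) (hw : ContinuousOn w (Icc a b))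
    (hx : x ∈ Icc (0 : ℝ) 1) (hy : y ∈ Icc (0 : ℝ) 1) (hxa : u x = a) (hyb : u y = b)
    (hwp : ∀ z ∈ Icc a b, w z ^ 2 ≤ -z ^ 4 + κ * z ^ 2 + l * z + ν) :
    (∫ s in (0 : ℝ)..1, u s ^ 4) + 2 * K * ∫ s in a..b, w s ≤
      K ^ 2 * (∫ s in (0 : ℝ)..1, derivWithin u (Icc 0 1) s ^ 2) +
        κ * (∫ s in (0 : ℝ)..1, u s ^ 2) + ν := by
  have h1 := calibration (K := K) hu hmaps hw hx hy
  rw [hxa, hyb] at h1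
  have hint : ∀ f : ℝ → ℝ, ContinuousOn f (Icc 0 1) →
      IntervalIntegrable f MeasureTheory.volume 0 1 := fun f hf =>
    (hf.mono (by rw [uIcc_of_le zero_le_one])).intervalIntegrable
  have hc := hu.continuousOn
  have hwu : ContinuousOn (fun s => w (u s)) (Icc 0 1) := hw.comp hc hmaps
  have i4 : IntervalIntegrable (fun s => u s ^ 4) MeasureTheory.volume 0 1 := hint _ (hc.pow 4)
  have i2 : IntervalIntegrable (fun s => u s ^ 2) MeasureTheory.volume 0 1 := hint _ (hc.pow 2)
  have i1 : IntervalIntegrable (fun s => u s) MeasureTheory.volume 0 1 := hint _ hc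
  have i4' : IntervalIntegrable (fun s => -u s ^ 4) MeasureTheory.volume 0 1 := i4.neg
  have i0 : IntervalIntegrable (fun _ : ℝ => ν) MeasureTheory.volume 0 1 :=
    intervalIntegrable_const
  have h2 : ∫ s in (0 : ℝ)..1, w (u s) ^ 2 ≤
      ∫ s in (0 : ℝ)..1, (-u s ^ 4 + κ * u s ^ 2 + l * u s + ν) := by
    apply intervalIntegral.integral_mono_on zero_le_one (hint _ (hwu.pow 2))
    · exact ((i4'.add (i2.const_mul κ)).add (i1.const_mul l)).add i0
    · intro s hs
      exact hwp _ (hmaps hs)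
  have h3 : ∫ s in (0 : ℝ)..1, (-u s ^ 4 + κ * u s ^ 2 + l * u s + ν) =
      -(∫ s in (0 : ℝ)..1, u s ^ 4) + κ * (∫ s in (0 : ℝ)..1, u s ^ 2) + ν := by
    rw [intervalIntegral.integral_add ((i4'.add (i2.const_mul κ)).add (i1.const_mul l)) i0,
      intervalIntegral.integral_add (i4'.add (i2.const_mul κ)) (i1.const_mul l),
      intervalIntegral.integral_add i4' (i2.const_mul κ), intervalIntegral.integral_neg,
      intervalIntegral.integral_const_mul, intervalIntegral.integral_const_mul, hmean]
    simp
  linarith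

/-- The calibration inequality for a function of range `[c - 1, c + 1]`. In the variable
`z = y - c` the quartic is `(1 - z²)(z² + 4cz + r)`, the general one without cubic term that
vanishes at both end points, and the weight is `√(1 - z²) (S(z²) + 2cz / S(z²))`. Its odd part
integrates to zero, so only `S` is left on the left-hand side. -/
theorem profile_calibration {u S : ℝ → ℝ} {c r x y K : ℝ}
    (hu : ContDiffOn ℝ 1 u (Icc 0 1)) (hmean : ∫ s in (0 : ℝ)..1, u s = 0)
    (hmaps : MapsTo u (Icc 0 1) (Icc (c - 1) (c + 1)))
    (hx : x ∈ Icc (0 : ℝ) 1) (hy : y ∈ Icc (0 : ℝ) 1) (hxa : u x = c - 1) (hyb : u y = c + 1)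
    (hS : ContinuousOn S (Icc 0 1)) (hpos : ∀ s ∈ Icc (0 : ℝ) 1, 0 < S s)
    (hSr : ∀ s ∈ Icc (0 : ℝ) 1, S s ^ 2 + 4 * c ^ 2 * s / S s ^ 2 ≤ s + r) :
    (∫ s in (0 : ℝ)..1, u s ^ 4) + 2 * K * ∫ z in (-1 : ℝ)..1, √(1 - z ^ 2) * S (z ^ 2) ≤
      K ^ 2 * (∫ s in (0 : ℝ)..1, derivWithin u (Icc 0 1) s ^ 2) +
        (6 * c ^ 2 + 1 - r) * (∫ s in (0 : ℝ)..1, u s ^ 2) +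
        (1 - c ^ 2) * (r - 3 * c ^ 2) := by
  have hsq : MapsTo (fun z : ℝ => z ^ 2) (Icc (-1) 1) (Icc 0 1) := fun z hz =>
    ⟨sq_nonneg z, by nlinarith [hz.1, hz.2]⟩
  have hS2 : ContinuousOn (fun z : ℝ => S (z ^ 2)) (Icc (-1) 1) :=
    hS.comp (by fun_prop) hsq
  have hroot : ContinuousOn (fun z : ℝ => √(1 - z ^ 2)) (Icc (-1) 1) := by fun_prop
  have hpos2 : ∀ z ∈ Icc (-1 : ℝ) 1, 0 < S (z ^ 2) := fun z hz => hpos _ (hsq hz)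
  have hodd : ContinuousOn (fun z : ℝ => √(1 - z ^ 2) * (2 * c * z / S (z ^ 2))) (Icc (-1) 1) :=
    hroot.mul ((by fun_prop : ContinuousOn (fun z : ℝ => 2 * c * z) _).div hS2
      fun z hz => (hpos2 z hz).ne')
  set v : ℝ → ℝ := fun z => √(1 - z ^ 2) * S (z ^ 2) + √(1 - z ^ 2) * (2 * c * z / S (z ^ 2))
    with hv
  have hvc : ContinuousOn v (Icc (-1) 1) := (hroot.mul hS2).add hodd
  have hshift : MapsTo (fun z : ℝ => z - c) (Icc (c - 1) (c + 1)) (Icc (-1) 1) := fun z hz =>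
    ⟨by linarith [hz.1], by linarith [hz.2]⟩
  have h := quartic_calibration (K := K) (w := fun z => v (z - c)) (κ := 6 * c ^ 2 + 1 - r)
    (l := 2 * c * (r + 1 - 4 * c ^ 2)) (ν := (1 - c ^ 2) * (r - 3 * c ^ 2)) hu hmean hmaps
    (hvc.comp (by fun_prop) hshift) hx hy hxa hyb ?_
  · have e1 : ∫ s in c - 1..c + 1, v (s - c) = ∫ z in (-1 : ℝ)..1, v z := by
      rw [intervalIntegral.integral_comp_sub_right]
      congr 1 <;> ring
    have ii : ∀ f : ℝ → ℝ, ContinuousOn f (Icc (-1) 1) →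
        IntervalIntegrable f MeasureTheory.volume (-1) 1 := fun f hf =>
      (hf.mono (by rw [uIcc_of_le (by norm_num)])).intervalIntegrable
    have e2 : ∫ z in (-1 : ℝ)..1, √(1 - z ^ 2) * (2 * c * z / S (z ^ 2)) = 0 := by
      have h0 := intervalIntegral.integral_comp_neg (a := (-1 : ℝ)) (b := 1)
        (fun z => √(1 - z ^ 2) * (2 * c * z / S (z ^ 2)))
      have h1 : (fun z : ℝ => √(1 - (-z) ^ 2) * (2 * c * (-z) / S ((-z) ^ 2))) =
          fun z => -(√(1 - z ^ 2) * (2 * c * z / S (z ^ 2))) := by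
        funext z
        rw [neg_sq]
        ring
      rw [h1, intervalIntegral.integral_neg, neg_neg] at h0
      linarith
    have e3 : ∫ z in (-1 : ℝ)..1, v z = ∫ z in (-1 : ℝ)..1, √(1 - z ^ 2) * S (z ^ 2) := by
      have h3 := intervalIntegral.integral_add (ii _ (hroot.mul hS2)) (ii _ hodd)
      rw [e2, add_zero] at h3
      exact h3
    rwa [e1, e3] at h
  · intro y hy
    have hz := hshift hy
    obtain ⟨z, rfl⟩ : ∃ z, y = z + c := ⟨y - c, by ring⟩
    simp only [add_sub_cancel_right] at hz ⊢
    have hs := hpos2 z hz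
    have h1 : 0 ≤ 1 - z ^ 2 := by linarith [(hsq hz).2]
    have e : v z ^ 2 = (1 - z ^ 2) * (S (z ^ 2) ^ 2 + 4 * c ^ 2 * z ^ 2 / S (z ^ 2) ^ 2 +
        4 * c * z) := by
      rw [hv]
      simp only
      rw [← mul_add, mul_pow, Real.sq_sqrt h1]
      field_simp
      ring
    rw [e]
    have := mul_le_mul_of_nonneg_left (add_le_add_left (hSr _ (hsq hz)) (4 * c * z)) h1
    nlinarith [this]

/-! ### Functions of small mass, and constant profiles -/

theorem integral_id_mul_sqrt {b a : ℝ} (ha : 0 ≤ a) (hab : a ≤ b) :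
    ∫ y in (0 : ℝ)..a, y * √(b ^ 2 - y ^ 2) = (b ^ 3 - √(b ^ 2 - a ^ 2) ^ 3) / 3 := by
  have hb : 0 ≤ b := ha.trans hab
  have h := intervalIntegral.integral_eq_sub_of_hasDerivAt_of_le (a := 0) (b := a)
    (f := fun y => -(√(b ^ 2 - y ^ 2) ^ 3 / 3)) (f' := fun y => y * √(b ^ 2 - y ^ 2)) ha
    (by fun_prop) ?_ ((by fun_prop : Continuous _).intervalIntegrable _ _)
  · rw [h]
    simp [Real.sqrt_sq hb]
    ring
  · intro y hy
    have hpos : 0 < b ^ 2 - y ^ 2 := by nlinarith [hy.1, hy.2]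
    have h1 : HasDerivAt (fun y : ℝ => b ^ 2 - y ^ 2) (-(2 * y)) y := by
      simpa using ((hasDerivAt_pow 2 y).const_sub (b ^ 2))
    have h2 : HasDerivAt (fun y : ℝ => -(√(b ^ 2 - y ^ 2) ^ 3 / 3)) _ y :=
      (((h1.sqrt hpos.ne').pow 3).div_const 3).neg
    refine h2.congr_deriv ?_
    have : √(b ^ 2 - y ^ 2) ≠ 0 := (Real.sqrt_pos.2 hpos).ne'
    field_simp
    push_cast
    ring

theorem integral_abs_mul_sqrt {c : ℝ} (hc : 0 ≤ c) (hc1 : c ≤ 1) :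
    ∫ y in c - 1..c + 1, |y| * √((1 + c) ^ 2 - y ^ 2) =
      (2 * (1 + c) ^ 3 - 8 * √c ^ 3) / 3 := by
  have hcont : Continuous fun y : ℝ => |y| * √((1 + c) ^ 2 - y ^ 2) := by fun_prop
  rw [← intervalIntegral.integral_add_adjacent_intervals
    (hcont.intervalIntegrable (c - 1) 0) (hcont.intervalIntegrable 0 (c + 1))]
  have h1 : ∫ y in c - 1..0, |y| * √((1 + c) ^ 2 - y ^ 2) =
      ∫ y in (0 : ℝ)..1 - c, |y| * √((1 + c) ^ 2 - y ^ 2) := by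
    have := intervalIntegral.integral_comp_neg (a := c - 1) (b := 0)
      (fun y => |y| * √((1 + c) ^ 2 - y ^ 2))
    simp only [abs_neg, neg_sq] at this
    rw [this]
    congr 1 <;> ring
  have h2 : ∀ a : ℝ, 0 ≤ a → ∫ y in (0 : ℝ)..a, |y| * √((1 + c) ^ 2 - y ^ 2) =
      ∫ y in (0 : ℝ)..a, y * √((1 + c) ^ 2 - y ^ 2) := by
    intro a ha
    refine intervalIntegral.integral_congr fun y hy => ?_
    rw [uIcc_of_le ha] at hy
    simp only [abs_of_nonneg hy.1]
  rw [h1, h2 _ (by linarith), h2 _ (by linarith), integral_id_mul_sqrt (by linarith) (by linarith),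
    integral_id_mul_sqrt (by linarith) (by linarith)]
  have e1 : √((1 + c) ^ 2 - (1 - c) ^ 2) = 2 * √c := by
    rw [show (1 + c) ^ 2 - (1 - c) ^ 2 = 2 ^ 2 * c by ring, Real.sqrt_mul (by norm_num),
      Real.sqrt_sq (by norm_num)]
  have e2 : √((1 + c) ^ 2 - (c + 1) ^ 2) = 0 := by
    rw [show (1 + c) ^ 2 - (c + 1) ^ 2 = 0 by ring, Real.sqrt_zero]
  rw [e1, e2]
  ring

/-- The left side is smallest relative to the right one near `g = 0.728`, where the two differ by
less than one percent. -/
theorem small_mass_ineq {g : ℝ} (hg : 0 ≤ g) (hg1 : g ≤ 1) :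
    0.466 * (1 + g ^ 2) ^ 2 ≤
      2 * 0.4028373 * ((2 * (1 + g ^ 2) ^ 3 - 8 * g ^ 3) / 3) := by
  nlinarith [sq_nonneg (g - 0.728), sq_nonneg (g * (g - 0.728)),
    sq_nonneg (g ^ 2 * (g - 0.728)), mul_nonneg hg (sq_nonneg (g - 0.728)),
    mul_nonneg hg (sq_nonneg (g * (g - 0.728))), sq_nonneg ((g + 1) * (g - 0.728)),
    sq_nonneg ((g ^ 2 + g) * (g - 0.728)), sub_nonneg.2 hg1]

/-- When `∫ u² = t²` is small, the quartic `z² ((1 + c)² - z²)` gives a good calibration. -/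
theorem interpolation_of_small_mass {u : ℝ → ℝ} {c t x y : ℝ}
    (hu : ContDiffOn ℝ 1 u (Icc 0 1)) (hmean : ∫ s in (0 : ℝ)..1, u s = 0)
    (hmaps : MapsTo u (Icc 0 1) (Icc (c - 1) (c + 1)))
    (hx : x ∈ Icc (0 : ℝ) 1) (hy : y ∈ Icc (0 : ℝ) 1) (hxa : u x = c - 1) (hyb : u y = c + 1)
    (hc : 0 ≤ c) (hc1 : c ≤ 1) (ht : 0 ≤ t) (htA : ∫ s in (0 : ℝ)..1, u s ^ 2 = t ^ 2)
    (ht1 : t ≤ 0.466) :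
    (∫ s in (0 : ℝ)..1, u s ^ 4) ≤
      (0.4028373 * t) ^ 2 * (∫ s in (0 : ℝ)..1, derivWithin u (Icc 0 1) s ^ 2) := by
  have h := quartic_calibration (K := 0.4028373 * t)
    (w := fun y => |y| * √((1 + c) ^ 2 - y ^ 2)) (κ := (1 + c) ^ 2)
    (l := 0) (ν := 0) hu hmean hmaps (by fun_prop) hx hy hxa hyb ?_
  · rw [integral_abs_mul_sqrt hc hc1, htA] at h
    have h1 := small_mass_ineq (Real.sqrt_nonneg c) (Real.sqrt_le_one.2 hc1)
    rw [Real.sq_sqrt hc] at h1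
    have h2 := mul_le_mul_of_nonneg_left h1 ht
    have h3 : t ^ 2 * (1 + c) ^ 2 ≤ t * 0.466 * (1 + c) ^ 2 := by
      rw [sq t]
      gcongr
    nlinarith
  · intro z hz
    have : 0 ≤ (1 + c) ^ 2 - z ^ 2 := by nlinarith [hz.1, hz.2]
    simp only [mul_pow, sq_abs, Real.sq_sqrt this]
    linarith [sq_nonneg z]

/-- For `c ≥ 1/2` a constant profile `ρ`, with `r = ρ²`, is good enough. The right-hand factor
`1.2655` is slightly less than `0.4028373 π`. -/
theorem exists_const_profile {c t : ℝ} (hc : 1 / 2 ≤ c) (hc1 : c < 1) (ht : 0.466 ≤ t)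
    (htc : t ^ 2 ≤ 1 - c ^ 2) :
    ∃ ρ : ℝ, 2 * c ≤ ρ ∧
      (6 * c ^ 2 + 1 - ρ ^ 2) * t ^ 2 + (1 - c ^ 2) * (ρ ^ 2 - 3 * c ^ 2) ≤ 1.2655 * t * ρ := by
  obtain ⟨q, hq⟩ : ∃ q : ℝ, q = 1.2655 := ⟨_, rfl⟩
  rw [← hq]
  have ht1 : t ≤ 1 := by nlinarith
  -- the difference of the two sides is a quadratic polynomial in `ρ` with leading coefficient `M`
  obtain ⟨M, hM⟩ : ∃ M, M = 1 - c ^ 2 - t ^ 2 := ⟨_, rfl⟩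
  rcases (show 0 ≤ M by linarith).eq_or_lt with h0 | h0
  · refine ⟨10, by linarith, ?_⟩
    have : t ^ 2 = 1 - c ^ 2 := by linarith
    rw [hq, this]
    nlinarith [sq_nonneg (c ^ 2 - 1 / 2)]
  · rcases le_total (4 * c * M) (q * t) with h | h
    · -- the minimum of the quadratic polynomial is admissible
      refine ⟨q * t / (2 * M), ?_, ?_⟩
      · rw [le_div_iff₀ (by positivity)]
        linarith
      · obtain ⟨e, he⟩ : ∃ e, e = c ^ 2 := ⟨_, rfl⟩
        obtain ⟨T, hT⟩ : ∃ T, T = t ^ 2 := ⟨_, rfl⟩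
        have he4 : 1 / 4 ≤ e := by nlinarith
        have he1 : e < 1 := by nlinarith
        have hTp : 0 < T := by rw [hT]; positivity
        have key : 0 ≤ (6 * e + 1) * T ^ 2 - ((1 - e) * (9 * e + 1) - q ^ 2 / 4) * T +
            3 * e * (1 - e) ^ 2 := by
          rcases le_total ((1 - e) * (9 * e + 1) - q ^ 2 / 4) 0 with hB | hB
          · have : 0 ≤ -((1 - e) * (9 * e + 1) - q ^ 2 / 4) * T :=
              mul_nonneg (by linarith) hTp.le
            have : 0 ≤ (6 * e + 1) * T ^ 2 := by positivity
            have : 0 ≤ 3 * e * (1 - e) ^ 2 := by positivity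
            linarith
          · have hd : ((1 - e) * (9 * e + 1) - q ^ 2 / 4) ^ 2 ≤
                12 * e * (6 * e + 1) * (1 - e) ^ 2 := by
              rw [hq] at hB ⊢
              have p := mul_nonneg (sub_nonneg.2 he4) (sub_nonneg.2 he1.le)
              nlinarith [p, mul_nonneg p (sub_nonneg.2 he4), mul_nonneg p p]
            have h6 : 0 < 6 * e + 1 := by linarith
            nlinarith [sq_nonneg (2 * (6 * e + 1) * T - ((1 - e) * (9 * e + 1) - q ^ 2 / 4))]
        have e1 : q * t * (q * t / (2 * M)) = q ^ 2 * T / (2 * M) := by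
          rw [hT]; field_simp
        have e2 : (q * t / (2 * M)) ^ 2 = q ^ 2 * T / (4 * M ^ 2) := by
          rw [hT]; field_simp; ring
        rw [e1, e2, ← he, ← hT]
        have hM' : M = 1 - e - T := by rw [hM, he, hT]
        have e3 : (6 * e + 1 - q ^ 2 * T / (4 * M ^ 2)) * T +
            (1 - e) * (q ^ 2 * T / (4 * M ^ 2) - 3 * e) =
            (6 * e + 1) * T - 3 * e * (1 - e) + (1 - e - T) * (q ^ 2 * T / (4 * M ^ 2)) := by ring
        have e4 : (1 - e - T) * (q ^ 2 * T / (4 * M ^ 2)) = q ^ 2 * T / (4 * M) := by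
          rw [← hM']; field_simp
        have e5 : q ^ 2 * T / (2 * M) = q ^ 2 * T / (4 * M) + q ^ 2 * T / (4 * M) := by
          field_simp; ring
        rw [e3, e4, e5]
        have : (6 * e + 1) * T - 3 * e * (1 - e) ≤ q ^ 2 * T / (4 * M) := by
          rw [le_div_iff₀ (by positivity), hM']
          nlinarith
        linarith
    · -- the minimum lies to the left of the admissible interval `[2c, ∞)`
      refine ⟨2 * c, le_rfl, ?_⟩
      have h62 : t < 0.62 := by
        by_contra! hcon
        have h1 : c * (1 - c ^ 2) ≤ 0.385 := by
          nlinarith [mul_nonneg (sq_nonneg (c - 0.57735)) (by linarith : (0 : ℝ) ≤ c + 1.1547)]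
        rw [hq, hM] at h
        nlinarith [mul_nonneg (sub_nonneg.2 hc) (sq_nonneg t)]
      rw [hq]
      have p := mul_nonneg (sub_nonneg.2 ht) (sub_nonneg.2 h62.le)
      have p' := mul_nonneg (sub_nonneg.2 hc) (sub_nonneg.2 hc1.le)
      nlinarith [p, p', mul_nonneg (sub_nonneg.2 hc) (sub_nonneg.2 ht),
        mul_nonneg (sub_nonneg.2 hc) (sub_nonneg.2 h62.le), mul_nonneg p (sub_nonneg.2 hc),
        mul_nonneg p' (sub_nonneg.2 hc)]

/-! ### Moments of the semicircle law -/

theorem integral_sqrt_one_sub_sq_mul_pow_succ (j : ℕ) :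
    (2 * j + 4 : ℝ) * ∫ z in (-1 : ℝ)..1, √(1 - z ^ 2) * (1 - z ^ 2) ^ (j + 1) =
      (2 * j + 3) * ∫ z in (-1 : ℝ)..1, √(1 - z ^ 2) * (1 - z ^ 2) ^ j := by
  have ii : ∀ i : ℕ, IntervalIntegrable (fun z : ℝ => √(1 - z ^ 2) * (1 - z ^ 2) ^ i)
      MeasureTheory.volume (-1) 1 := fun i =>
    (by fun_prop : Continuous fun z : ℝ => √(1 - z ^ 2) * (1 - z ^ 2) ^ i).intervalIntegrable _ _
  have h := intervalIntegral.integral_eq_sub_of_hasDerivAt_of_le (a := -1) (b := 1)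
    (f := fun z : ℝ => z * ((1 - z ^ 2) ^ (j + 1) * √(1 - z ^ 2)))
    (f' := fun z => (2 * j + 4) * (√(1 - z ^ 2) * (1 - z ^ 2) ^ (j + 1)) -
      (2 * j + 3) * (√(1 - z ^ 2) * (1 - z ^ 2) ^ j)) (by norm_num) (by fun_prop) ?_
      (((ii _).const_mul _).sub ((ii _).const_mul _))
  · rw [intervalIntegral.integral_sub ((ii _).const_mul _) ((ii _).const_mul _),
      intervalIntegral.integral_const_mul, intervalIntegral.integral_const_mul] at h
    norm_num at h
    linarith
  · intro z hz
    have hpos : 0 < 1 - z ^ 2 := by nlinarith [hz.1, hz.2]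
    have h1 : HasDerivAt (fun y : ℝ => 1 - y ^ 2) (-(2 * z)) z := by
      simpa using ((hasDerivAt_pow 2 z).const_sub 1)
    have h2 : HasDerivAt (fun z : ℝ => z * ((1 - z ^ 2) ^ (j + 1) * √(1 - z ^ 2))) _ z :=
      (hasDerivAt_id z).mul ((h1.pow (j + 1)).mul (h1.sqrt hpos.ne'))
    refine h2.congr_deriv ?_
    have h3 : √(1 - z ^ 2) ≠ 0 := (Real.sqrt_pos.2 hpos).ne'
    have h4 : √(1 - z ^ 2) ^ 2 = 1 - z ^ 2 := Real.sq_sqrt hpos.le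
    simp only [Pi.pow_apply, id_eq, Nat.add_sub_cancel]
    push_cast
    have h5 : (1 - z ^ 2) ^ (j + 1) * (-(2 * z) / (2 * √(1 - z ^ 2))) =
        -z * (1 - z ^ 2) ^ j * √(1 - z ^ 2) := by
      rw [mul_div_assoc', div_eq_iff (by positivity), pow_succ]
      linear_combination (2 * z * (1 - z ^ 2) ^ j) * h4
    rw [h5, pow_succ]
    ring

/-! ### Polynomials with rational coefficients as lists -/

/-- The value at `x` of the polynomial with coefficients `l`, constant term first. -/
def listEval : List ℚ → ℝ → ℝ
  | [], _ => 0
  | a :: l, x => a + x * listEval l x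

/-- The sum of two polynomials given by their coefficients. -/
def listAdd : List ℚ → List ℚ → List ℚ
  | [], m => m
  | l, [] => l
  | a :: l, b :: m => (a + b) :: listAdd l m

/-- A scalar multiple of a polynomial given by its coefficients. -/
def listSmul (c : ℚ) (l : List ℚ) : List ℚ := l.map (c * ·)

/-- The product of two polynomials given by their coefficients. -/
def listMul : List ℚ → List ℚ → List ℚ
  | [], _ => []
  | a :: l, m => listAdd (listSmul a m) (0 :: listMul l m)

/-- A power of a polynomial given by its coefficients. -/
def listPow (l : List ℚ) : ℕ → List ℚ
  | 0 => [1]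
  | n + 1 => listMul (listPow l n) l

theorem listEval_add (l m : List ℚ) (x : ℝ) :
    listEval (listAdd l m) x = listEval l x + listEval m x := by
  induction l generalizing m with
  | nil => simp [listAdd, listEval]
  | cons a l ih =>
    cases m with
    | nil => simp [listAdd, listEval]
    | cons b m => simp only [listAdd, listEval, ih]; push_cast; ring

theorem listEval_smul (c : ℚ) (l : List ℚ) (x : ℝ) :
    listEval (listSmul c l) x = c * listEval l x := by
  induction l with
  | nil => simp [listSmul, listEval]
  | cons a l ih =>
    simp only [listSmul, List.map_cons, listEval] at ih ⊢
    rw [ih]; push_cast; ring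

theorem listEval_mul (l m : List ℚ) (x : ℝ) :
    listEval (listMul l m) x = listEval l x * listEval m x := by
  induction l with
  | nil => simp [listMul, listEval]
  | cons a l ih =>
    simp only [listMul, listEval_add, listEval_smul, listEval, ih]; push_cast; ring

theorem listEval_pow (l : List ℚ) (n : ℕ) (x : ℝ) :
    listEval (listPow l n) x = listEval l x ^ n := by
  induction n with
  | zero => simp [listPow, listEval]
  | succ n ih => rw [listPow, listEval_mul, ih, pow_succ]

theorem continuous_listEval (l : List ℚ) : Continuous (listEval l) := by
  induction l with
  | nil => exact continuous_const
  | cons a l ih => exact continuous_const.add (continuous_id.mul ih)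

/-- `semicircleMean l 0 1` is the mean of `l(1 - z²)` with respect to the semicircle density
`(2/π) √(1 - z²)` on `[-1, 1]`. In general `m` stands for the mean of `(1 - z²)ʲ`, and the value is
the mean of `(1 - z²)ʲ l(1 - z²)`. -/
def semicircleMean : List ℚ → ℕ → ℚ → ℚ
  | [], _, _ => 0
  | a :: l, j, m => a * m + semicircleMean l (j + 1) (m * (2 * j + 3) / (2 * j + 4))

theorem integral_semicircle_listEval_aux (l : List ℚ) (j : ℕ) (m : ℚ)
    (hm : ∫ z in (-1 : ℝ)..1, √(1 - z ^ 2) * (1 - z ^ 2) ^ j = Real.pi / 2 * m) :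
    ∫ z in (-1 : ℝ)..1, √(1 - z ^ 2) * ((1 - z ^ 2) ^ j * listEval l (1 - z ^ 2)) =
      Real.pi / 2 * semicircleMean l j m := by
  induction l generalizing j m with
  | nil => simp [listEval, semicircleMean]
  | cons a l ih =>
    have hl := continuous_listEval l
    have h1 := ih (j + 1) (m * (2 * j + 3) / (2 * j + 4)) (by
      have := integral_sqrt_one_sub_sq_mul_pow_succ j
      rw [hm] at this
      have h4 : (2 * j + 4 : ℝ) ≠ 0 := by positivity
      rw [eq_comm, ← mul_right_inj' h4, this]
      push_cast
      field_simp)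
    have e : ∀ z : ℝ, √(1 - z ^ 2) * ((1 - z ^ 2) ^ j * listEval (a :: l) (1 - z ^ 2)) =
        a * (√(1 - z ^ 2) * (1 - z ^ 2) ^ j) +
          √(1 - z ^ 2) * ((1 - z ^ 2) ^ (j + 1) * listEval l (1 - z ^ 2)) := fun z => by
      rw [listEval]; ring
    simp only [e]
    rw [intervalIntegral.integral_add, intervalIntegral.integral_const_mul, hm, h1, semicircleMean]
    · push_cast; ring
    · exact Continuous.intervalIntegrable (by fun_prop) _ _
    · exact Continuous.intervalIntegrable (by fun_prop) _ _

theorem integral_semicircle_listEval (l : List ℚ) :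
    ∫ z in (-1 : ℝ)..1, √(1 - z ^ 2) * listEval l (1 - z ^ 2) =
      Real.pi / 2 * semicircleMean l 0 1 := by
  have := integral_semicircle_listEval_aux l 0 1 (by
    simpa using integral_sqrt_one_sub_sq)
  simpa using this

/-- The coefficients of the polynomial `∑ bⱼ xʲ (1 - x)^(d - j)` of degree `d` with
`l = [b₀, …, b_d]`. It is nonnegative on `[0, 1]` as soon as all `bⱼ` are. -/
def bernsteinList : List ℚ → List ℚ
  | [] => []
  | b :: l => listAdd (listSmul b (listPow [1, -1] l.length)) (0 :: bernsteinList l)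

theorem listEval_bernsteinList_nonneg {l : List ℚ} (hl : ∀ b ∈ l, 0 ≤ b) {x : ℝ}
    (hx : x ∈ Icc (0 : ℝ) 1) : 0 ≤ listEval (bernsteinList l) x := by
  induction l with
  | nil => simp [bernsteinList, listEval]
  | cons b l ih =>
    have h1 : listEval [1, -1] x = 1 - x := by simp [listEval]; ring
    rw [bernsteinList, listEval_add, listEval_smul, listEval_pow, h1, listEval]
    have hb : (0 : ℝ) ≤ b := by exact_mod_cast hl b (by simp)
    have := ih fun b hb => hl b (by simp [hb])
    have hx1 : 0 ≤ 1 - x := by linarith [hx.2]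
    have := mul_nonneg hx.1 this
    have := mul_nonneg hb (pow_nonneg hx1 l.length)
    push_cast
    linarith

/-- One Newton step towards `1 / √X`, starting from `Y`, never overshoots, and its error is
quadratic in that of `Y`. -/
theorem mul_three_sub_le_sqrt {X Y : ℝ} (hX : 0 ≤ X) (hY : 0 ≤ Y) :
    X * Y * (3 - X * Y ^ 2) / 2 ≤ √X := by
  obtain ⟨a, ha, rfl⟩ : ∃ a : ℝ, 0 ≤ a ∧ X = a ^ 2 := ⟨√X, Real.sqrt_nonneg X, (Real.sq_sqrt hX).symm⟩
  rw [Real.sqrt_sq ha]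
  have : 0 ≤ a * ((a * Y - 1) ^ 2 * (a * Y + 2)) := by positivity
  nlinarith

/-- A polynomial lower bound of `√(N / D)`: the Newton step for `1 / √(N / D)` that starts from the
approximation `D w`, multiplied by `N / D`. -/
def sqrtLowerList (N D w : List ℚ) : List ℚ :=
  listSmul (1 / 2) (listMul (listMul N w)
    (listAdd [3] (listSmul (-1) (listMul (listMul N D) (listMul w w)))))

theorem listEval_sqrtLowerList_le {N D w : List ℚ} {x : ℝ} (hN : 0 ≤ listEval N x)
    (hD : 0 < listEval D x) (hw : 0 ≤ listEval w x) :
    listEval (sqrtLowerList N D w) x ≤ √(listEval N x / listEval D x) := by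
  have h := mul_three_sub_le_sqrt (div_nonneg hN hD.le) (mul_nonneg hD.le hw)
  refine le_of_eq_of_le ?_ h
  simp only [sqrtLowerList, listEval_smul, listEval_mul, listEval_add, listEval]
  push_cast
  field_simp
  ring

/-! ### Profiles and the parameter rectangles -/

/-- The profile `S` used for `c < 1/2`, with `e = c²`. For `e = 0` it is `√(s + r)`, which is
optimal in the symmetric case; in general it makes the condition of `profile_calibration` hold with
`r + 4e / (1 + r)` in place of `r`. -/
noncomputable def profile (r e s : ℝ) : ℝ :=
  √(s + r + 4 * e * r / (1 + r) * (1 - s) / (s + r))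

theorem profile_arg_ge {r e s : ℝ} (hr : 0 < r) (he : 0 ≤ e) (hs : s ∈ Icc (0 : ℝ) 1) :
    s + r ≤ s + r + 4 * e * r / (1 + r) * (1 - s) / (s + r) := by
  have h1 : 0 ≤ 1 - s := by linarith [hs.2]
  have h2 : 0 ≤ s := hs.1
  have : 0 ≤ 4 * e * r / (1 + r) * (1 - s) / (s + r) := by positivity
  linarith

theorem profile_pos {r e s : ℝ} (hr : 0 < r) (he : 0 ≤ e) (hs : s ∈ Icc (0 : ℝ) 1) :
    0 < profile r e s :=
  Real.sqrt_pos.2 (lt_of_lt_of_le (by linarith [hs.1]) (profile_arg_ge hr he hs))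

theorem continuousOn_profile {r e : ℝ} (hr : 0 < r) : ContinuousOn (profile r e) (Icc 0 1) := by
  unfold profile
  refine ContinuousOn.sqrt (ContinuousOn.add (by fun_prop) (ContinuousOn.div (by fun_prop)
    (by fun_prop) fun s hs => ?_))
  linarith [hs.1]

theorem profile_sq_add_le {r e s : ℝ} (hr : 0 < r) (he : 0 ≤ e) (hs : s ∈ Icc (0 : ℝ) 1) :
    profile r e s ^ 2 + 4 * e * s / profile r e s ^ 2 ≤ s + (r + 4 * e / (1 + r)) := by
  have h := profile_arg_ge hr he hs
  have hsr : 0 < s + r := by linarith [hs.1]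
  have hsq : profile r e s ^ 2 = s + r + 4 * e * r / (1 + r) * (1 - s) / (s + r) :=
    Real.sq_sqrt (hsr.le.trans h)
  have h1 : 4 * e * s / profile r e s ^ 2 ≤ 4 * e * s / (s + r) := by
    rw [hsq]
    have := hs.1
    gcongr
  have h2 : 4 * e * r / (1 + r) * (1 - s) / (s + r) + 4 * e * s / (s + r) =
      4 * e / (1 + r) := by
    field_simp
    ring
  linarith

/-- The radicand of the profile is an affine function of `e`. -/
theorem profile_concave {r e₀ e₁ l s : ℝ} (hr : 0 < r) (h₀ : 0 ≤ e₀) (h₁ : 0 ≤ e₁)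
    (hl : l ∈ Icc (0 : ℝ) 1) (hs : s ∈ Icc (0 : ℝ) 1) :
    (1 - l) * profile r e₀ s + l * profile r e₁ s ≤ profile r ((1 - l) * e₀ + l * e₁) s := by
  have hsr : 0 ≤ s + r := by linarith [hs.1]
  have := Real.strictConcaveOn_sqrt.concaveOn.2
    (mem_Ici.2 (hsr.trans (profile_arg_ge hr h₀ hs)))
    (mem_Ici.2 (hsr.trans (profile_arg_ge hr h₁ hs)))
    (by linarith [hl.2] : 0 ≤ 1 - l) hl.1 (by ring)
  simp only [smul_eq_mul] at this
  refine this.trans_eq ?_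
  unfold profile
  congr 1
  ring

/-- The integral of the profile against the weight `√(1 - z²)`. -/
noncomputable def profileIntegral (r e : ℝ) : ℝ :=
  ∫ z in (-1 : ℝ)..1, √(1 - z ^ 2) * profile r e (z ^ 2)

theorem sq_mem_Icc {z : ℝ} (hz : z ∈ Icc (-1 : ℝ) 1) : z ^ 2 ∈ Icc (0 : ℝ) 1 :=
  ⟨sq_nonneg z, by nlinarith [hz.1, hz.2]⟩

theorem intervalIntegrable_profile {r e : ℝ} (hr : 0 < r) :
    IntervalIntegrable (fun z : ℝ => √(1 - z ^ 2) * profile r e (z ^ 2))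
      MeasureTheory.volume (-1) 1 := by
  refine ContinuousOn.intervalIntegrable ?_
  rw [uIcc_of_le (by norm_num)]
  exact ContinuousOn.mul (by fun_prop)
    ((continuousOn_profile hr).comp (by fun_prop) fun z hz => sq_mem_Icc hz)

theorem profileIntegral_concave {r e₀ e₁ l : ℝ} (hr : 0 < r) (h₀ : 0 ≤ e₀) (h₁ : 0 ≤ e₁)
    (hl : l ∈ Icc (0 : ℝ) 1) :
    (1 - l) * profileIntegral r e₀ + l * profileIntegral r e₁ ≤
      profileIntegral r ((1 - l) * e₀ + l * e₁) := by
  unfold profileIntegral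
  rw [← intervalIntegral.integral_const_mul, ← intervalIntegral.integral_const_mul,
    ← intervalIntegral.integral_add ((intervalIntegrable_profile hr).const_mul _)
      ((intervalIntegrable_profile hr).const_mul _)]
  refine intervalIntegral.integral_mono_on (by norm_num)
    (((intervalIntegrable_profile hr).const_mul _).add
      ((intervalIntegrable_profile hr).const_mul _)) (intervalIntegrable_profile hr) fun z hz => ?_
  have := mul_le_mul_of_nonneg_left (profile_concave hr h₀ h₁ hl (sq_mem_Icc hz))
    (Real.sqrt_nonneg (1 - z ^ 2))
  linarith

/-- A rational lower bound of the semicircle mean of the profile. The list `b` holds Bernstein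
coefficients of an approximation of `1 / √(N D)`, where the radicand of the profile is `N / D` as a
function of `1 - s`; for `e = 0` the fraction is reduced. -/
def profileLower (r e : ℚ) (b : List ℚ) : ℚ :=
  if e = 0 then semicircleMean (sqrtLowerList [1 + r, -1] [1] (bernsteinList b)) 0 1
  else semicircleMean (sqrtLowerList [(1 + r) ^ 2, -2 * (1 + r) + 4 * e * r / (1 + r), 1]
    [1 + r, -1] (bernsteinList b)) 0 1

theorem profileLower_le {r e : ℚ} {b : List ℚ} (hr : 0 < r) (he : 0 ≤ e)
    (hb : ∀ a ∈ b, 0 ≤ a) :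
    Real.pi / 2 * profileLower r e b ≤ profileIntegral r e := by
  have hr' : (0 : ℝ) < r := by exact_mod_cast hr
  have he' : (0 : ℝ) ≤ e := by exact_mod_cast he
  have main : ∀ N D : List ℚ,
      (∀ x ∈ Icc (0 : ℝ) 1, 0 ≤ listEval N x ∧ 0 < listEval D x ∧
        √(listEval N x / listEval D x) = profile r e (1 - x)) →
      Real.pi / 2 * semicircleMean (sqrtLowerList N D (bernsteinList b)) 0 1 ≤
        profileIntegral r e := by
    intro N D h
    rw [← integral_semicircle_listEval, profileIntegral]
    refine intervalIntegral.integral_mono_on (by norm_num) ?_ (intervalIntegrable_profile hr')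
      fun z hz => ?_
    · have := continuous_listEval (sqrtLowerList N D (bernsteinList b))
      exact Continuous.intervalIntegrable (by fun_prop) _ _
    · have hz' := sq_mem_Icc hz
      have hx : 1 - z ^ 2 ∈ Icc (0 : ℝ) 1 := ⟨by linarith [hz'.2], by linarith [hz'.1]⟩
      obtain ⟨h1, h2, h3⟩ := h _ hx
      have := listEval_sqrtLowerList_le h1 h2 (listEval_bernsteinList_nonneg hb hx)
      rw [h3, sub_sub_cancel] at this
      gcongr
  unfold profileLower
  split_ifs with h0
  · refine main _ _ fun x hx => ?_
    have : 0 ≤ 1 - x := by linarith [hx.2]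
    have e1 : listEval [1 + r, -1] x = 1 - x + r := by simp [listEval]; ring
    have e2 : listEval [1] x = 1 := by simp [listEval]
    rw [e1, e2, h0]
    refine ⟨by positivity, one_pos, ?_⟩
    simp [profile]
  · refine main _ _ fun x hx => ?_
    have h1 : 0 ≤ 1 - x := by linarith [hx.2]
    have e1 : listEval [1 + r, -1] x = 1 - x + r := by simp [listEval]; ring
    have e2 : listEval [(1 + r) ^ 2, -2 * (1 + r) + 4 * e * r / (1 + r), 1] x =
        (1 - x + r) ^ 2 + 4 * e * r / (1 + r) * x := by
      simp only [listEval]; push_cast; ring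
    rw [e1, e2]
    have h2 : 0 < 1 - x + r := by positivity
    have h3 := hx.1
    refine ⟨by positivity, h2, ?_⟩
    rw [profile]
    congr 1
    field_simp
    ring

/-- A rectangle `[e₀, e₁] × [t₀, t₁]` of parameters `e = c²` and `t = (∫ u²)^(1/2)`, with the
parameter `r` of the profile used on it and the approximations `b₀`, `b₁` for `profileLower` at
`e₀` and `e₁`. -/
structure Cell where
  r : ℚ
  e₀ : ℚ
  e₁ : ℚ
  t₀ : ℚ
  t₁ : ℚ
  b₀ : List ℚ
  b₁ : List ℚ

/-- The amount by which the calibration with the profile `(r, e)` beats the desired inequality at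
`t`, when `V` is a lower bound of the semicircle mean of the profile. -/
def defectLower (r e t V : ℚ) : ℚ :=
  3.141592653 * 0.4028373 * t * V - (6 * e + 1 - (r + 4 * e / (1 + r))) * t ^ 2 -
    (1 - e) * (r + 4 * e / (1 + r) - 3 * e)

/-- The defect is nonnegative at the corners of the rectangle. The defect is concave in `t`, and
concave in `e` up to the term `(4 / (1 + r) - 3) e²`, whose deviation from its chord is made up for
by the positive lower bound at `e₁`. -/
def Cell.Valid (Q : Cell) : Prop :=
  0 < Q.r ∧ Q.r ≤ 1 ∧ 0 ≤ Q.e₀ ∧ Q.e₀ < Q.e₁ ∧ 0 ≤ Q.t₀ ∧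
    (∀ a ∈ Q.b₀, 0 ≤ a) ∧ (∀ a ∈ Q.b₁, 0 ≤ a) ∧
    0 ≤ profileLower Q.r Q.e₀ Q.b₀ ∧ 0 ≤ profileLower Q.r Q.e₁ Q.b₁ ∧
    0 ≤ defectLower Q.r Q.e₀ Q.t₀ (profileLower Q.r Q.e₀ Q.b₀) ∧
    0 ≤ defectLower Q.r Q.e₀ Q.t₁ (profileLower Q.r Q.e₀ Q.b₀) ∧
    max 0 ((4 / (1 + Q.r) - 3) * (Q.e₁ - Q.e₀) ^ 2) ≤
      defectLower Q.r Q.e₁ Q.t₀ (profileLower Q.r Q.e₁ Q.b₁) ∧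
    max 0 ((4 / (1 + Q.r) - 3) * (Q.e₁ - Q.e₀) ^ 2) ≤
      defectLower Q.r Q.e₁ Q.t₁ (profileLower Q.r Q.e₁ Q.b₁)

instance (Q : Cell) : Decidable Q.Valid := by
  unfold Cell.Valid
  infer_instance

theorem concave_quadratic_ge {A B D m t t₀ t₁ : ℝ} (hB : 0 ≤ B) (h₀ : m ≤ A * t₀ - B * t₀ ^ 2 - D)
    (h₁ : m ≤ A * t₁ - B * t₁ ^ 2 - D) (ht : t ∈ Icc t₀ t₁) : m ≤ A * t - B * t ^ 2 - D := by
  have h01 : t₀ ≤ t₁ := ht.1.trans ht.2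
  rcases h01.eq_or_lt with h | h
  · obtain rfl : t = t₀ := le_antisymm (h ▸ ht.2) ht.1
    exact h₀
  · have h2 : 0 ≤ B * ((t - t₀) * (t₁ - t)) :=
      mul_nonneg hB (mul_nonneg (sub_nonneg.2 ht.1) (sub_nonneg.2 ht.2))
    have h3 := mul_le_mul_of_nonneg_left h₀ (sub_nonneg.2 ht.2)
    have h4 := mul_le_mul_of_nonneg_left h₁ (sub_nonneg.2 ht.1)
    have h5 : 0 < t₁ - t₀ := sub_pos.2 h
    have h6 := mul_nonneg h2 h5.le
    refine le_of_mul_le_mul_left ?_ h5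
    nlinarith

theorem Cell.Valid.profile_bound {Q : Cell} (hQ : Q.Valid) {e t : ℝ}
    (he : e ∈ Icc (Q.e₀ : ℝ) Q.e₁) (ht : t ∈ Icc (Q.t₀ : ℝ) Q.t₁) :
    (6 * e + 1 - (Q.r + 4 * e / (1 + Q.r))) * t ^ 2 +
        (1 - e) * (Q.r + 4 * e / (1 + Q.r) - 3 * e) ≤
      2 * (0.4028373 * t) * profileIntegral Q.r e := by
  obtain ⟨hr, hr1, he0, he01, ht0, hb0, hb1, hV0, hV1, h00, h01, h10, h11⟩ := hQ
  have I0 := profileLower_le hr he0 hb0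
  have I1 := profileLower_le hr (he0.trans he01.le) hb1
  generalize profileLower Q.r Q.e₀ Q.b₀ = V₀ at *
  generalize profileLower Q.r Q.e₁ Q.b₁ = V₁ at *
  generalize hm : max 0 ((4 / (1 + Q.r) - 3) * (Q.e₁ - Q.e₀) ^ 2) = m at *
  have hm0 : 0 ≤ m := hm ▸ le_max_left _ _
  have hm1 : (4 / (1 + Q.r) - 3) * (Q.e₁ - Q.e₀) ^ 2 ≤ m := hm ▸ le_max_right _ _
  obtain ⟨r, e₀, e₁, t₀, t₁, b₀, b₁⟩ := Q
  simp only [defectLower] at *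
  rw [← Rat.cast_le (K := ℝ)] at hr1 he0 ht0 hV0 hV1 h00 h01 h10 h11 hm0 hm1
  rw [← Rat.cast_lt (K := ℝ)] at hr he01
  push_cast at hr hr1 he0 he01 ht0 hV0 hV1 h00 h01 h10 h11 hm0 hm1
  generalize (r : ℝ) = r at *
  generalize (e₀ : ℝ) = e₀ at *
  generalize (e₁ : ℝ) = e₁ at *
  generalize (t₀ : ℝ) = t₀ at *
  generalize (t₁ : ℝ) = t₁ at *
  generalize (V₀ : ℝ) = V₀ at *
  generalize (V₁ : ℝ) = V₁ at *
  generalize (m : ℝ) = m at *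
  obtain ⟨μ, hμ⟩ : ∃ μ, μ = 4 / (1 + r) := ⟨_, rfl⟩
  have hμe : ∀ e : ℝ, 4 * e / (1 + r) = μ * e := fun e => by rw [hμ]; ring
  have hμ4 : μ ≤ 4 := by rw [hμ, div_le_iff₀ (by linarith)]; linarith
  simp only [hμe] at h00 h01 h10 h11 ⊢
  rw [← hμ] at hm1
  have ht' : 0 ≤ t := ht0.trans ht.1
  -- concavity in `t` at the two ends of the `e`-interval
  have c0 := concave_quadratic_ge (A := 3.141592653 * 0.4028373 * V₀)
    (B := 6 * e₀ + 1 - (r + μ * e₀)) (D := (1 - e₀) * (r + μ * e₀ - 3 * e₀)) (m := 0)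
    (by nlinarith) (by linarith) (by linarith) ht
  have c1 := concave_quadratic_ge (A := 3.141592653 * 0.4028373 * V₁)
    (B := 6 * e₁ + 1 - (r + μ * e₁)) (D := (1 - e₁) * (r + μ * e₁ - 3 * e₁)) (m := m)
    (by nlinarith) (by linarith) (by linarith) ht
  obtain ⟨l, hl, rfl⟩ : ∃ l ∈ Icc (0 : ℝ) 1, e = (1 - l) * e₀ + l * e₁ := by
    refine ⟨(e - e₀) / (e₁ - e₀), ⟨div_nonneg (by linarith [he.1]) (by linarith),
      div_le_one_of_le₀ (by linarith [he.2]) (by linarith)⟩, ?_⟩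
    have : e₁ - e₀ ≠ 0 := by linarith
    field_simp
    ring
  have hI := profileIntegral_concave hr he0 (he0.trans he01.le) hl
  have hl0 : 0 ≤ l := hl.1
  have hl1 : 0 ≤ 1 - l := by linarith [hl.2]
  have hpi : (3.141592653 : ℝ) ≤ Real.pi := by linarith [Real.pi_gt_d20]
  have J0 : 3.141592653 / 2 * V₀ ≤ profileIntegral r e₀ :=
    le_trans (by gcongr) I0
  have J1 : 3.141592653 / 2 * V₁ ≤ profileIntegral r e₁ :=
    le_trans (by gcongr) I1
  have J : (1 - l) * (3.141592653 / 2 * V₀) + l * (3.141592653 / 2 * V₁) ≤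
      profileIntegral r ((1 - l) * e₀ + l * e₁) := le_trans (by gcongr) hI
  have J' := mul_le_mul_of_nonneg_left J (by positivity : (0 : ℝ) ≤ 2 * (0.4028373 * t))
  refine le_trans ?_ J'
  have d0 := mul_nonneg hl1 c0
  have d1 := mul_le_mul_of_nonneg_left c1 hl0
  have d2 : (μ - 3) * (e₁ - e₀) ^ 2 * (l * (1 - l)) ≤ l * m := by
    have h1 := mul_le_mul_of_nonneg_right hm1 (mul_nonneg hl0 hl1)
    have h2 : 0 ≤ m * (l * l) := by positivity
    linarith
  linarith

/-! ### Cover of the parameters by rectangles -/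

/-- The list of the fractions `k / n` for `k` in a list of numerators. -/
def scaled (n : ℕ) (l : List ℕ) : List ℚ := l.map fun k => (k : ℚ) / n

/-- A cover of the parameters with `0 ≤ e ≤ 0.04`. The inequality is nearly an equality
at `e = 0`, `t ≈ 0.6398`, with `r ≈ 0.2905`, which is why the approximations there are precise. -/
def strip₁ : List Cell := [
  ⟨0.225, 0, 0.04, 0.466, 0.6243,
    scaled 100 [91, 384, 746, 449, 209],
    scaled 100 [73, 533, 610, 2809, 405, 741]⟩,
  ⟨0.285, 0, 0.04, 0.6243, 0.6386,
    scaled 1000 [882, 5617, 15361, 21332, 19136, 8033, 1872],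
    scaled 100 [70, 275, 1111, 269, 542]⟩,
  ⟨0.29, 0, 0.04, 0.6386, 0.6397,
    scaled 100000 [88044, 826672, 3458863, 8532493, 13406855, 14579494, 10240834, 4934474, 1351686, 185692],
    scaled 100 [70, 277, 1087, 283, 530]⟩,
  ⟨0.2906, 0, 0.04, 0.6397, 0.64043,
    scaled 100000 [88024, 826463, 3457948, 8529643, 13403269, 14572514, 10237508, 4931426, 1350944, 185501],
    scaled 100 [70, 277, 1084, 284, 529]⟩,
  ⟨0.294, 0, 0.04, 0.64043, 0.645,
    scaled 10000 [8790, 65007, 205814, 374986, 391952, 273320, 98044, 18440],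
    scaled 100 [70, 278, 1069, 292, 521]⟩,
  ⟨0.302, 0, 0.04, 0.645, 0.6643,
    scaled 1000 [876, 4754, 10032, 12051, 6229, 1818],
    scaled 100 [69, 279, 1035, 310, 503]⟩,
  ⟨0.46, 0, 0.04, 0.6643, 1,
    scaled 100 [83, 357, 609, 437, 147],
    scaled 100 [57, 266, 654, 414, 287]⟩]

/-- A cover of the parameters with `0.04 ≤ e ≤ 0.1`. -/
def strip₂ : List Cell := [
  ⟨0.255, 0.04, 0.1, 0.466, 0.6,
    scaled 100 [70, 491, 733, 2360, 563, 631],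
    scaled 100 [72, 317, 1006, 446, 515]⟩,
  ⟨0.33, 0.04, 0.1, 0.6, 0.64,
    scaled 100 [66, 282, 933, 358, 448],
    scaled 100 [63, 330, 227, 376]⟩,
  ⟨0.42, 0.04, 0.1, 0.64, 0.69,
    scaled 100 [60, 273, 718, 413, 325],
    scaled 100 [58, 272, 251, 281]⟩,
  ⟨0.58, 0.04, 0.1, 0.69, 0.98,
    scaled 100 [50, 221, 217, 207],
    scaled 100 [50, 212, 236, 188]⟩]

/-- A cover of the parameters with `0.1 ≤ e ≤ 0.16`. -/
def strip₃ : List Cell := [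
  ⟨0.32, 0.1, 0.16, 0.466, 0.605,
    scaled 100 [67, 310, 816, 494, 394],
    scaled 100 [66, 322, 746, 559, 348]⟩,
  ⟨0.5, 0.1, 0.16, 0.605, 0.68,
    scaled 100 [54, 238, 248, 227],
    scaled 100 [54, 229, 266, 207]⟩,
  ⟨0.7, 0.1, 0.16, 0.68, 0.949,
    scaled 100 [45, 182, 215, 147],
    scaled 100 [45, 178, 220, 137]⟩]

/-- A cover of the parameters with `0.16 ≤ e ≤ 0.25`. -/
def strip₄ : List Cell := [
  ⟨0.44, 0.16, 0.25, 0.466, 0.63,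
    scaled 100 [57, 250, 278, 240],
    scaled 100 [58, 240, 297, 213]⟩,
  ⟨0.9, 0.16, 0.25, 0.63, 0.917,
    scaled 100 [38, 146, 181, 100],
    scaled 100 [38, 143, 181, 93]⟩]
theorem strips_valid : ∀ Q ∈ strip₁ ++ strip₂ ++ strip₃ ++ strip₄, Q.Valid := by decide +kernel

/-- Two rectangles over the same interval of `e`, the second one continuing the first one in `t`. -/
def Cell.Abuts (P Q : Cell) : Prop := P.e₀ = Q.e₀ ∧ P.e₁ = Q.e₁ ∧ P.t₁ = Q.t₀

instance : DecidableRel Cell.Abuts := fun P Q => by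
  unfold Cell.Abuts
  infer_instance

theorem exists_cell_of_isChain {e t : ℝ} (l : List Cell) :
    ∀ Q : Cell, List.IsChain Cell.Abuts (Q :: l) → e ∈ Icc (Q.e₀ : ℝ) Q.e₁ → (Q.t₀ : ℝ) ≤ t →
      t ≤ ((Q :: l).getLast (by simp)).t₁ →
      ∃ P ∈ Q :: l, e ∈ Icc (P.e₀ : ℝ) P.e₁ ∧ t ∈ Icc (P.t₀ : ℝ) P.t₁ := by
  induction l with
  | nil =>
    intro Q _ he h0 h1
    exact ⟨Q, by simp, he, h0, by simpa using h1⟩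
  | cons P l ih =>
    intro Q hQ he h0 h1
    rw [List.isChain_cons_cons] at hQ
    obtain ⟨⟨ha, hb, hc⟩, hl⟩ := hQ
    rcases le_total t Q.t₁ with h | h
    · exact ⟨Q, by simp, he, h0, h⟩
    · obtain ⟨R, hR, hR'⟩ := ih P hl (by rwa [← ha, ← hb]) (by rwa [← hc]) (by simpa using h1)
      exact ⟨R, List.mem_cons_of_mem _ hR, hR'⟩

theorem exists_base_profile {e t : ℝ} (he : 0 ≤ e) (he1 : e ≤ 1 / 4) (ht : 0.466 ≤ t)
    (hte : t ^ 2 ≤ 1 - e) :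
    ∃ r : ℝ, 0 < r ∧
      (6 * e + 1 - (r + 4 * e / (1 + r))) * t ^ 2 + (1 - e) * (r + 4 * e / (1 + r) - 3 * e) ≤
        2 * (0.4028373 * t) * profileIntegral r e := by
  suffices h : ∃ Q ∈ strip₁ ++ strip₂ ++ strip₃ ++ strip₄,
      e ∈ Icc (Q.e₀ : ℝ) Q.e₁ ∧ t ∈ Icc (Q.t₀ : ℝ) Q.t₁ by
    obtain ⟨Q, hQ, he, ht⟩ := h
    exact ⟨Q.r, by exact_mod_cast (strips_valid Q hQ).1, (strips_valid Q hQ).profile_bound he ht⟩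
  simp only [List.mem_append]
  rcases le_total e 0.04 with h | h
  · obtain ⟨P, hP, h⟩ := exists_cell_of_isChain (e := e) (t := t) _ _
      (by decide +kernel : List.IsChain Cell.Abuts strip₁)
      (by constructor <;> norm_num <;> linarith) (by norm_num; linarith)
      (by norm_num [strip₁]; nlinarith)
    exact ⟨P, by tauto, h⟩
  rcases le_total e 0.1 with h' | h'
  · obtain ⟨P, hP, h⟩ := exists_cell_of_isChain (e := e) (t := t) _ _
      (by decide +kernel : List.IsChain Cell.Abuts strip₂)
      (by constructor <;> norm_num <;> linarith) (by norm_num; linarith)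
      (by norm_num [strip₂]; nlinarith)
    exact ⟨P, by tauto, h⟩
  rcases le_total e 0.16 with h'' | h''
  · obtain ⟨P, hP, h⟩ := exists_cell_of_isChain (e := e) (t := t) _ _
      (by decide +kernel : List.IsChain Cell.Abuts strip₃)
      (by constructor <;> norm_num <;> linarith) (by norm_num; linarith)
      (by norm_num [strip₃]; nlinarith)
    exact ⟨P, by tauto, h⟩
  · obtain ⟨P, hP, h⟩ := exists_cell_of_isChain (e := e) (t := t) _ _
      (by decide +kernel : List.IsChain Cell.Abuts strip₄)
      (by constructor <;> norm_num <;> linarith) (by norm_num; linarith)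
      (by norm_num [strip₄]; nlinarith)
    exact ⟨P, by tauto, h⟩

/-! ### The inequality on the unit interval -/

theorem interpolation_of_range_eq {u : ℝ → ℝ} {c x y : ℝ}
    (hu : ContDiffOn ℝ 1 u (Icc 0 1)) (hmean : ∫ s in (0 : ℝ)..1, u s = 0)
    (hmaps : MapsTo u (Icc 0 1) (Icc (c - 1) (c + 1)))
    (hx : x ∈ Icc (0 : ℝ) 1) (hy : y ∈ Icc (0 : ℝ) 1) (hxa : u x = c - 1) (hyb : u y = c + 1)
    (hc : 0 ≤ c) (hc1 : c ≤ 1) :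
    ∫ s in (0 : ℝ)..1, u s ^ 4 ≤ 0.4028373 ^ 2 * (∫ s in (0 : ℝ)..1, u s ^ 2) *
      ∫ s in (0 : ℝ)..1, derivWithin u (Icc 0 1) s ^ 2 := by
  have hint : ∀ f : ℝ → ℝ, ContinuousOn f (Icc 0 1) →
      IntervalIntegrable f MeasureTheory.volume 0 1 := fun f hf =>
    (hf.mono (by rw [uIcc_of_le zero_le_one])).intervalIntegrable
  have hcu := hu.continuousOn
  have hA0 : 0 ≤ ∫ s in (0 : ℝ)..1, u s ^ 2 :=
    intervalIntegral.integral_nonneg zero_le_one fun s _ => sq_nonneg _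
  obtain ⟨t, ht, htA⟩ : ∃ t : ℝ, 0 ≤ t ∧ ∫ s in (0 : ℝ)..1, u s ^ 2 = t ^ 2 :=
    ⟨_, Real.sqrt_nonneg _, (Real.sq_sqrt hA0).symm⟩
  -- the bound of the variance in terms of the extreme values
  have hAc : t ^ 2 ≤ 1 - c ^ 2 := by
    have h1 : ∫ s in (0 : ℝ)..1, u s ^ 2 ≤ ∫ s in (0 : ℝ)..1, (2 * c * u s + (1 - c ^ 2)) := by
      refine intervalIntegral.integral_mono_on zero_le_one (hint _ (hcu.pow 2))
        (((hint _ hcu).const_mul _).add intervalIntegrable_const) fun s hs => ?_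
      have := hmaps hs
      nlinarith [mul_nonneg (sub_nonneg.2 this.1) (sub_nonneg.2 this.2)]
    rw [intervalIntegral.integral_add ((hint _ hcu).const_mul _) intervalIntegrable_const,
      intervalIntegral.integral_const_mul, hmean, htA] at h1
    simpa using h1
  suffices h : ∫ s in (0 : ℝ)..1, u s ^ 4 ≤
      (0.4028373 * t) ^ 2 * ∫ s in (0 : ℝ)..1, derivWithin u (Icc 0 1) s ^ 2 by
    rwa [htA, ← mul_pow]
  -- the calibration constant is `K = 0.4028373 t`, so that `K²` is the constant times `∫ u²`
  rcases le_total t 0.466 with ht1 | ht1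
  · exact interpolation_of_small_mass hu hmean hmaps hx hy hxa hyb hc hc1 ht htA ht1
  rcases le_total (1 / 2) c with hc2 | hc2
  · obtain ⟨ρ, hρ, h⟩ := exists_const_profile hc2 (by nlinarith) ht1 hAc
    have hρ0 : 0 < ρ := by linarith
    have h1 := profile_calibration (K := 0.4028373 * t) (S := fun _ => ρ) (r := ρ ^ 2) hu hmean
      hmaps hx hy hxa hyb continuousOn_const (fun _ _ => hρ0) fun s hs => by
        have : 4 * c ^ 2 * s / ρ ^ 2 ≤ s := by
          rw [div_le_iff₀ (by positivity)]
          nlinarith [mul_le_mul_of_nonneg_left (pow_le_pow_left₀ (by positivity) hρ 2) hs.1]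
        linarith
    rw [intervalIntegral.integral_mul_const, integral_sqrt_one_sub_sq, htA] at h1
    have hpi : 1.2655 * t * ρ ≤ 2 * (0.4028373 * t) * (Real.pi / 2 * ρ) := by
      have : (1.2655 : ℝ) ≤ 0.4028373 * Real.pi := by linarith [Real.pi_gt_d4]
      nlinarith [mul_le_mul_of_nonneg_right this (mul_nonneg ht hρ0.le)]
    linarith
  · obtain ⟨r, hr, h⟩ := exists_base_profile (sq_nonneg c) (by nlinarith) ht1 hAc
    have he := sq_nonneg c
    have h1 := profile_calibration (K := 0.4028373 * t) (S := profile r (c ^ 2)) hu hmean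
      hmaps hx hy hxa hyb (continuousOn_profile hr) (fun s hs => profile_pos hr he hs)
      fun s hs => profile_sq_add_le hr he hs
    rw [htA] at h1
    change _ + 2 * _ * profileIntegral r (c ^ 2) ≤ _ at h1
    linarith

/-- Both sides of the inequality are homogeneous of degree four. -/
theorem interpolation_of_const_mul {u : ℝ → ℝ} {k C : ℝ} (hk : k ≠ 0)
    (h : ∫ s in (0 : ℝ)..1, (k * u s) ^ 4 ≤ C * (∫ s in (0 : ℝ)..1, (k * u s) ^ 2) *
      ∫ s in (0 : ℝ)..1, derivWithin (fun s => k * u s) (Icc 0 1) s ^ 2) :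
    ∫ s in (0 : ℝ)..1, u s ^ 4 ≤ C * (∫ s in (0 : ℝ)..1, u s ^ 2) *
      ∫ s in (0 : ℝ)..1, derivWithin u (Icc 0 1) s ^ 2 := by
  have hd : ∀ s, derivWithin (fun s => k * u s) (Icc 0 1) s = k * derivWithin u (Icc 0 1) s :=
    fun s => by rw [derivWithin_const_mul_field]
  simp only [hd, mul_pow, intervalIntegral.integral_const_mul] at h
  have hk4 : 0 < k ^ 4 := by positivity
  refine le_of_mul_le_mul_left (h.trans_eq ?_) hk4
  ring

/-- The inequality on `[0, 1]`, with a constant that exceeds the optimal one by about `6e-8`. -/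
theorem interpolation_unit {u : ℝ → ℝ} (hu : ContDiffOn ℝ 1 u (Icc 0 1))
    (hmean : ∫ s in (0 : ℝ)..1, u s = 0) :
    ∫ s in (0 : ℝ)..1, u s ^ 4 ≤ 0.4028373 ^ 2 * (∫ s in (0 : ℝ)..1, u s ^ 2) *
      ∫ s in (0 : ℝ)..1, derivWithin u (Icc 0 1) s ^ 2 := by
  have hcu := hu.continuousOn
  have hne : (Icc (0 : ℝ) 1).Nonempty := nonempty_Icc.2 zero_le_one
  obtain ⟨x, hx, hxm⟩ := isCompact_Icc.exists_isMinOn hne hcu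
  obtain ⟨y, hy, hyM⟩ := isCompact_Icc.exists_isMaxOn hne hcu
  have hmin : ∀ s ∈ Icc (0 : ℝ) 1, u x ≤ u s := fun s hs => hxm hs
  have hmax : ∀ s ∈ Icc (0 : ℝ) 1, u s ≤ u y := fun s hs => hyM hs
  have hiu : IntervalIntegrable u MeasureTheory.volume 0 1 :=
    (hcu.mono (by rw [uIcc_of_le zero_le_one])).intervalIntegrable
  have hm0 : u x ≤ 0 := by
    have := intervalIntegral.integral_mono_on zero_le_one intervalIntegrable_const hiu hmin
    rw [hmean] at this
    simpa using this
  have hM0 : 0 ≤ u y := by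
    have := intervalIntegral.integral_mono_on zero_le_one hiu intervalIntegrable_const hmax
    rw [hmean] at this
    simpa using this
  rcases (hmin y hy).eq_or_lt with h | h
  · -- a constant function of mean zero vanishes
    have hz : ∀ s ∈ Icc (0 : ℝ) 1, u s = 0 := fun s hs =>
      le_antisymm ((hmax s hs).trans (h ▸ hm0)) (by linarith [hmin s hs])
    have h4 : ∫ s in (0 : ℝ)..1, u s ^ 4 = 0 := by
      rw [intervalIntegral.integral_congr (g := fun _ => 0)]
      · simp
      · intro s hs
        rw [uIcc_of_le zero_le_one] at hs
        simp [hz s hs]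
    rw [h4]
    have h1 : 0 ≤ ∫ s in (0 : ℝ)..1, u s ^ 2 :=
      intervalIntegral.integral_nonneg zero_le_one fun s _ => sq_nonneg _
    have h2 : 0 ≤ ∫ s in (0 : ℝ)..1, derivWithin u (Icc 0 1) s ^ 2 :=
      intervalIntegral.integral_nonneg zero_le_one fun s _ => sq_nonneg _
    positivity
  · have hd : 0 < u y - u x := sub_pos.2 h
    have hne : u y - u x ≠ 0 := hd.ne'
    have hcd : ∀ k : ℝ, ContDiffOn ℝ 1 (fun s => k * u s) (Icc 0 1) := fun k =>
      contDiffOn_const.mul hu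
    have hmk : ∀ k : ℝ, ∫ s in (0 : ℝ)..1, k * u s = 0 := fun k => by
      rw [intervalIntegral.integral_const_mul, hmean, mul_zero]
    rcases le_total 0 (u y + u x) with hs | hs
    · refine interpolation_of_const_mul (k := 2 / (u y - u x)) (by positivity)
        (interpolation_of_range_eq (c := (u y + u x) / (u y - u x)) (x := x) (y := y) (hcd _)
          (hmk _) (fun s hs => ⟨?_, ?_⟩) hx hy ?_ ?_ (by positivity) ?_)
      · rw [div_sub_one hne, div_mul_eq_mul_div, div_le_div_iff_of_pos_right hd]
        linarith [hmin s hs]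
      · rw [div_add_one hne, div_mul_eq_mul_div, div_le_div_iff_of_pos_right hd]
        linarith [hmax s hs]
      · field_simp; ring
      · field_simp; ring
      · rw [div_le_one hd]; linarith
    · refine interpolation_of_const_mul (k := -(2 / (u y - u x))) (by
          rw [neg_ne_zero]; positivity)
        (interpolation_of_range_eq (c := -(u y + u x) / (u y - u x)) (x := y) (y := x) (hcd _)
          (hmk _) (fun s hs => ⟨?_, ?_⟩) hy hx ?_ ?_ (div_nonneg (by linarith) hd.le) ?_)
      · rw [div_sub_one hne, ← neg_div, div_mul_eq_mul_div, div_le_div_iff_of_pos_right hd]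
        linarith [hmax s hs]
      · rw [div_add_one hne, ← neg_div, div_mul_eq_mul_div, div_le_div_iff_of_pos_right hd]
        linarith [hmin s hs]
      · field_simp; ring
      · field_simp; ring
      · rw [div_le_one hd]; linarith

/-! ### Independence of the length -/

open scoped Pointwise in
theorem derivWithin_dilation {L a : ℝ} {v : ℝ → ℝ} (ha : 0 < a) (x : ℝ) :
    derivWithin (fun x => v (a * x)) (Icc 0 L) x =
      a * derivWithin v (Icc 0 (a * L)) (a * x) := by
  rw [derivWithin_comp_mul_left, LinearOrderedField.smul_Icc ha, mul_zero, smul_eq_mul]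

theorem neumann_of_mul {n : ℕ∞} {L a : ℝ} {v : ℝ → ℝ} (ha : 0 < a)
    (hv : IsNeumannMeanZero n (a * L) v) : IsNeumannMeanZero n L (fun x => v (a * x)) := by
  have hd := derivWithin_dilation (L := L) (v := v) ha
  refine ⟨?_, ?_, ?_, ?_⟩
  · refine hv.contDiffOn.comp (by fun_prop) fun x hx => ?_
    exact ⟨mul_nonneg ha.le hx.1, mul_le_mul_of_nonneg_left hx.2 ha.le⟩
  · rw [hd, mul_zero, hv.deriv_left, mul_zero]
  · rw [hd, hv.deriv_right, mul_zero]
  · rw [intervalIntegral.integral_comp_mul_left _ ha.ne', mul_zero, hv.mean_zero, smul_zero]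

theorem interpolationIneq_of_mul {C L a : ℝ} {v : ℝ → ℝ} (ha : 0 < a)
    (h : InterpolationIneq C L (fun x => v (a * x))) : InterpolationIneq C (a * L) v := by
  have hd := derivWithin_dilation (L := L) (v := v) ha
  unfold InterpolationIneq at h ⊢
  simp only [hd, mul_pow, intervalIntegral.integral_const_mul] at h
  rw [intervalIntegral.integral_comp_mul_left (fun x => v x ^ 4) ha.ne',
    intervalIntegral.integral_comp_mul_left (fun x => v x ^ 2) ha.ne',
    intervalIntegral.integral_comp_mul_left (fun x => derivWithin v (Icc 0 (a * L)) x ^ 2) ha.ne',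
    mul_zero, smul_eq_mul, smul_eq_mul, smul_eq_mul] at h
  have := mul_le_mul_of_nonneg_left h ha.le
  refine le_of_eq_of_le ?_ (this.trans_eq ?_)
  · field_simp
  · field_simp

/-- Admissible constants do not depend on the length of the interval. -/
theorem admissible_of_admissible {n : ℕ∞} {C L L' : ℝ} (hL : 0 < L) (hL' : 0 < L')
    (h : ∀ u, IsNeumannMeanZero n L u → InterpolationIneq C L u) {v : ℝ → ℝ}
    (hv : IsNeumannMeanZero n L' v) : InterpolationIneq C L' v := by
  have ha : 0 < L' / L := div_pos hL' hL
  have e : L' = L' / L * L := by field_simp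
  rw [e] at hv ⊢
  exact interpolationIneq_of_mul ha (h _ (neumann_of_mul ha hv))

/-! ### Density of smooth functions -/

open Filter Topology

/-- A Weierstrass approximation is corrected by an affine function to vanish at the end points. -/
theorem exists_polynomial_near_of_vanishing {v : ℝ → ℝ} (hv : ContinuousOn v (Icc 0 1))
    (h0 : v 0 = 0) (h1 : v 1 = 0) {ε : ℝ} (hε : 0 < ε) :
    ∃ q : Polynomial ℝ, q.eval 0 = 0 ∧ q.eval 1 = 0 ∧ ∀ x ∈ Icc (0 : ℝ) 1, |q.eval x - v x| ≤ ε := by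
  obtain ⟨p, hp⟩ := exists_polynomial_near_of_continuousOn 0 1 v hv (ε / 2) (half_pos hε)
  refine ⟨p - Polynomial.C (p.eval 0) * (1 - Polynomial.X) - Polynomial.C (p.eval 1) * Polynomial.X,
    by simp, by simp, fun x hx => ?_⟩
  have a0 := hp 0 (by simp)
  have a1 := hp 1 (by simp)
  rw [h0, sub_zero] at a0
  rw [h1, sub_zero] at a1
  have a := hp x hx
  rw [abs_lt] at a a0 a1
  simp only [Polynomial.eval_sub, Polynomial.eval_mul, Polynomial.eval_C, Polynomial.eval_one,
    Polynomial.eval_X]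
  obtain ⟨hx0, hx1⟩ := hx
  rw [abs_le]
  constructor <;> nlinarith

/-- The approximation is a primitive of a polynomial close to `u'`, shifted to have mean zero. -/
theorem exists_smooth_near {u : ℝ → ℝ} (hu : IsNeumannMeanZero 1 1 u) {ε : ℝ} (hε : 0 < ε) :
    ∃ w, IsNeumannMeanZero ⊤ 1 w ∧ (∀ x ∈ Icc (0 : ℝ) 1, |w x - u x| ≤ ε) ∧
      ∀ x ∈ Icc (0 : ℝ) 1, |derivWithin w (Icc 0 1) x - derivWithin u (Icc 0 1) x| ≤ ε := by
  have hcd : ContDiffOn ℝ 1 u (Icc 0 1) := by simpa using hu.contDiffOn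
  have hdc : ContinuousOn (derivWithin u (Icc 0 1)) (Icc 0 1) :=
    hcd.continuousOn_derivWithin (uniqueDiffOn_Icc one_pos) le_rfl
  have hcu := hcd.continuousOn
  obtain ⟨q, q0, q1, hq⟩ := exists_polynomial_near_of_vanishing hdc hu.deriv_left hu.deriv_right
    (half_pos hε)
  have hqc : Continuous fun x => q.eval x := q.continuous
  have hii : ∀ a b : ℝ, IntervalIntegrable (fun x => q.eval x) MeasureTheory.volume a b :=
    fun a b => hqc.intervalIntegrable a b
  set F : ℝ → ℝ := fun x => ∫ s in (0 : ℝ)..x, q.eval s with hF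
  have hFd : ∀ x, HasDerivAt F (q.eval x) x := fun x =>
    intervalIntegral.integral_hasDerivAt_right (hii 0 x)
      hqc.aestronglyMeasurable.stronglyMeasurableAtFilter hqc.continuousAt
  have hFs : ContDiff ℝ (⊤ : ℕ∞) F := by
    rw [contDiff_infty_iff_deriv]
    refine ⟨fun x => (hFd x).differentiableAt, ?_⟩
    rw [show deriv F = fun x => q.eval x from funext fun x => (hFd x).deriv]
    simpa only [Polynomial.coe_aeval_eq_eval] using q.contDiff_aeval (𝕜 := ℝ) _
  have hFc : Continuous F := hFs.continuous
  -- `u - F` varies by at most `ε / 2`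
  have hdiff : ∀ x ∈ Icc (0 : ℝ) 1, |F x - (u x - u 0)| ≤ ε / 2 := by
    intro x hx
    have h1 : ∀ y ∈ Icc (0 : ℝ) 1, HasDerivWithinAt (fun y => F y - u y)
        (q.eval y - derivWithin u (Icc 0 1) y) (Icc 0 1) y := fun y hy =>
      (hFd y).hasDerivWithinAt.sub ((hcd.differentiableOn one_ne_zero) y hy).hasDerivWithinAt
    have := (convex_Icc (0 : ℝ) 1).norm_image_sub_le_of_norm_hasDerivWithin_le h1
      (fun y hy => by simpa using hq y hy) (left_mem_Icc.2 zero_le_one) hx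
    have F0 : F 0 = 0 := by simp [hF]
    rw [F0, Real.norm_eq_abs, Real.norm_eq_abs, sub_zero, abs_of_nonneg hx.1] at this
    calc |F x - (u x - u 0)| = |F x - u x - (0 - u 0)| := by ring_nf
      _ ≤ ε / 2 * x := this
      _ ≤ ε / 2 := by nlinarith [hx.2]
  set k : ℝ := ∫ s in (0 : ℝ)..1, F s with hk
  have hku : |k + u 0| ≤ ε / 2 := by
    have e : k + u 0 = ∫ s in (0 : ℝ)..1, (F s - (u s - u 0)) := by
      have hiu : IntervalIntegrable u MeasureTheory.volume 0 1 :=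
        (hcu.mono (by rw [uIcc_of_le zero_le_one])).intervalIntegrable
      rw [intervalIntegral.integral_sub (hFc.intervalIntegrable _ _)
        (hiu.sub intervalIntegrable_const), intervalIntegral.integral_sub hiu
        intervalIntegrable_const, hu.mean_zero]
      simp [hk]
    rw [e]
    have := intervalIntegral.norm_integral_le_of_norm_le_const (a := (0 : ℝ)) (b := 1)
      (f := fun s => F s - (u s - u 0)) (C := ε / 2) fun s hs => by
        rw [uIoc_of_le zero_le_one] at hs
        exact hdiff s (Ioc_subset_Icc_self hs)
    simpa using this
  have hwd : ∀ x ∈ Icc (0 : ℝ) 1, derivWithin (fun y => F y - k) (Icc 0 1) x = q.eval x :=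
    fun x hx => ((hFd x).sub_const k).hasDerivWithinAt.derivWithin
      (uniqueDiffOn_Icc one_pos x hx)
  refine ⟨fun x => F x - k, ⟨?_, ?_, ?_, ?_⟩, fun x hx => ?_, fun x hx => ?_⟩
  · exact (hFs.sub contDiff_const).contDiffOn
  · rw [hwd 0 (left_mem_Icc.2 zero_le_one), q0]
  · rw [hwd 1 (right_mem_Icc.2 zero_le_one), q1]
  · rw [intervalIntegral.integral_sub (hFc.intervalIntegrable _ _) intervalIntegrable_const]
    simp [hk]
  · have h1 := hdiff x hx
    rw [abs_le] at h1 hku ⊢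
    constructor <;> linarith
  · rw [hwd x hx]
    exact (hq x hx).trans (by linarith)

theorem tendsto_integral_pow {f : ℕ → ℝ → ℝ} {g : ℝ → ℝ} (p : ℕ)
    (hf : ∀ k, ContinuousOn (f k) (Icc 0 1)) (hg : ContinuousOn g (Icc 0 1))
    (h : ∀ k : ℕ, ∀ x ∈ Icc (0 : ℝ) 1, |f k x - g x| ≤ 1 / (k + 1)) :
    Tendsto (fun k => ∫ x in (0 : ℝ)..1, f k x ^ p) atTop (𝓝 (∫ x in (0 : ℝ)..1, g x ^ p)) := by
  obtain ⟨B, hB⟩ := isCompact_Icc.exists_bound_of_continuousOn hg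
  refine intervalIntegral.tendsto_integral_filter_of_dominated_convergence
    (fun _ => (B + 1) ^ p) (Eventually.of_forall fun k => ?_) (Eventually.of_forall fun k => ?_)
    intervalIntegrable_const ?_
  · rw [uIoc_of_le zero_le_one]
    exact (((hf k).pow p).mono Ioc_subset_Icc_self).aestronglyMeasurable measurableSet_Ioc
  · refine Eventually.of_forall fun x hx => ?_
    rw [uIoc_of_le zero_le_one] at hx
    have hx' := Ioc_subset_Icc_self hx
    rw [norm_pow]
    refine pow_le_pow_left₀ (norm_nonneg _) ?_ p
    have h1 : (1 : ℝ) / (k + 1) ≤ 1 := by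
      rw [div_le_one (by positivity)]; linarith [(Nat.cast_nonneg k : (0 : ℝ) ≤ k)]
    have h2 := norm_add_le (f k x - g x) (g x)
    rw [sub_add_cancel] at h2
    exact h2.trans (by linarith [hB x hx', h k x hx', Real.norm_eq_abs (f k x - g x)])
  · refine Eventually.of_forall fun x hx => ?_
    rw [uIoc_of_le zero_le_one] at hx
    refine Tendsto.pow ?_ p
    rw [tendsto_iff_norm_sub_tendsto_zero]
    exact squeeze_zero (fun k => norm_nonneg _) (fun k => h k x (Ioc_subset_Icc_self hx))
      tendsto_one_div_add_atTop_nhds_zero_nat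

/-- A constant admissible for smooth functions is admissible for functions of class `C¹`. -/
theorem interpolationIneq_of_smooth {C : ℝ}
    (h : ∀ w, IsNeumannMeanZero ⊤ 1 w → InterpolationIneq C 1 w) {u : ℝ → ℝ}
    (hu : IsNeumannMeanZero 1 1 u) : InterpolationIneq C 1 u := by
  choose w hw hwu hwd using fun k : ℕ =>
    exists_smooth_near hu (Nat.one_div_pos_of_nat (α := ℝ) (n := k))
  have c1 : ∀ {n : ℕ∞} {v : ℝ → ℝ}, 1 ≤ n → IsNeumannMeanZero n 1 v →
      ContDiffOn ℝ 1 v (Icc 0 1) := fun hn hv =>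
    hv.contDiffOn.of_le (by exact_mod_cast hn)
  have cd : ∀ {v : ℝ → ℝ}, ContDiffOn ℝ 1 v (Icc 0 1) →
      ContinuousOn (derivWithin v (Icc 0 1)) (Icc 0 1) := fun hv =>
    hv.continuousOn_derivWithin (uniqueDiffOn_Icc one_pos) le_rfl
  have hu1 := c1 le_rfl hu
  have hw1 := fun k => c1 le_top (hw k)
  have l4 := tendsto_integral_pow 4 (fun k => (hw1 k).continuousOn) hu1.continuousOn hwu
  have l2 := tendsto_integral_pow 2 (fun k => (hw1 k).continuousOn) hu1.continuousOn hwu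
  have ld := tendsto_integral_pow 2 (fun k => cd (hw1 k)) (cd hu1) hwd
  exact le_of_tendsto_of_tendsto' l4 ((l2.const_mul (C * 1)).mul ld) fun k => h _ (hw k)

/-! ### The trial function -/

/-- The polynomial `p` with `(x^(j + 1) p(x))' = xʲ l(x)`, given by its coefficients. -/
def listPrimitiveAux : List ℚ → ℕ → List ℚ
  | [], _ => []
  | a :: l, j => a / (j + 1) :: listPrimitiveAux l (j + 1)

/-- The primitive of a polynomial with value `k` at `0`, given by its coefficients. -/
def listPrimitive (k : ℚ) (l : List ℚ) : List ℚ := k :: listPrimitiveAux l 0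

theorem hasDerivAt_pow_mul_listPrimitiveAux (l : List ℚ) (j : ℕ) (x : ℝ) :
    HasDerivAt (fun x => x ^ (j + 1) * listEval (listPrimitiveAux l j) x) (x ^ j * listEval l x)
      x := by
  induction l generalizing j with
  | nil => simpa [listPrimitiveAux, listEval] using hasDerivAt_const x (0 : ℝ)
  | cons a l ih =>
    have h : HasDerivAt (fun x : ℝ => (a / (j + 1) : ℝ) * x ^ (j + 1) +
        x ^ (j + 1 + 1) * listEval (listPrimitiveAux l (j + 1)) x) _ x :=
      ((hasDerivAt_pow (j + 1) x).const_mul (a / (j + 1) : ℝ)).add (ih (j + 1))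
    convert h using 1
    · funext y
      simp only [listPrimitiveAux, listEval]
      push_cast
      ring
    · have : (j + 1 : ℝ) ≠ 0 := by positivity
      simp only [listEval, Nat.add_sub_cancel]
      push_cast
      field_simp
      ring

theorem hasDerivAt_listPrimitive (k : ℚ) (l : List ℚ) (x : ℝ) :
    HasDerivAt (listEval (listPrimitive k l)) (listEval l x) x := by
  have h := (hasDerivAt_pow_mul_listPrimitiveAux l 0 x).const_add (k : ℝ)
  simpa [listPrimitive, listEval] using h

theorem listEval_one (l : List ℚ) : listEval l 1 = (l.sum : ℚ) := by
  induction l with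
  | nil => simp [listEval]
  | cons a l ih => simp [listEval, ih]

theorem integral_listEval (l : List ℚ) :
    ∫ x in (0 : ℝ)..1, listEval l x = ((listPrimitive 0 l).sum : ℚ) := by
  rw [intervalIntegral.integral_eq_sub_of_hasDerivAt
    (fun x _ => hasDerivAt_listPrimitive 0 l x)
    ((continuous_listEval l).intervalIntegrable _ _), listEval_one]
  simp [listPrimitive, listEval]

theorem contDiff_listEval (l : List ℚ) {n : WithTop ℕ∞} : ContDiff ℝ n (listEval l) := by
  induction l with
  | nil => exact contDiff_const
  | cons a l ih => exact contDiff_const.add (contDiff_id.mul ih)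

/-- The derivative of the trial function: a multiple of
`(1 - y²)(200 + 461 y² + 184 y⁴ - 546 y⁶ + 161 y⁸)` with `y = 2x - 1`, which maximizes the quotient
among the odd polynomials of `y` of degree at most `11`, up to rounding. -/
def trialDeriv : List ℚ :=
  [0, 460, 200, -9128, 17812, 42880, -235904, 437248, -418432, 206080, -41216]

/-- A nearly optimal function, antisymmetric about the midpoint of `[0, 1]`; the quotient of the two
sides of the inequality exceeds `0.1622778` by about `1.7e-8`. -/
def trial : List ℚ := listPrimitive (-82828 / 3465) trialDeriv

theorem derivWithin_trial {x : ℝ} (hx : x ∈ Icc (0 : ℝ) 1) :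
    derivWithin (listEval trial) (Icc 0 1) x = listEval trialDeriv x :=
  (hasDerivAt_listPrimitive _ _ x).hasDerivWithinAt.derivWithin (uniqueDiffOn_Icc one_pos x hx)

theorem isNeumannMeanZero_trial {n : ℕ∞} : IsNeumannMeanZero n 1 (listEval trial) := by
  refine ⟨(contDiff_listEval _).contDiffOn, ?_, ?_, ?_⟩
  · rw [derivWithin_trial (by simp)]
    simp [trialDeriv, listEval]
  · rw [derivWithin_trial (by simp), listEval_one,
      show trialDeriv.sum = 0 by decide +kernel, Rat.cast_zero]
  · rw [integral_listEval, show (listPrimitive 0 trial).sum = 0 by decide +kernel, Rat.cast_zero]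

/-- Every constant admissible for the trial function is greater than `0.1622778`, uniformly. -/
theorem exists_lower_bound : ∃ ρ : ℝ, 0.1622778 < ρ ∧
    ∀ C, InterpolationIneq C 1 (listEval trial) → ρ ≤ C := by
  have hA : ∫ s in (0 : ℝ)..1, listEval trial s ^ 2 =
      ((listPrimitive 0 (listPow trial 2)).sum : ℚ) := by
    simp only [← listEval_pow, integral_listEval]
  have hQ : ∫ s in (0 : ℝ)..1, listEval trial s ^ 4 =
      ((listPrimitive 0 (listPow trial 4)).sum : ℚ) := by
    simp only [← listEval_pow, integral_listEval]
  have hD : ∫ s in (0 : ℝ)..1, derivWithin (listEval trial) (Icc 0 1) s ^ 2 =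
      ((listPrimitive 0 (listPow trialDeriv 2)).sum : ℚ) := by
    rw [← integral_listEval]
    refine intervalIntegral.integral_congr fun x hx => ?_
    rw [uIcc_of_le zero_le_one] at hx
    simp only [derivWithin_trial hx, listEval_pow]
  have key : 0 < (listPrimitive 0 (listPow trial 2)).sum *
        (listPrimitive 0 (listPow trialDeriv 2)).sum ∧
      0.1622778 * ((listPrimitive 0 (listPow trial 2)).sum *
        (listPrimitive 0 (listPow trialDeriv 2)).sum) <
          (listPrimitive 0 (listPow trial 4)).sum := by
    decide +kernel
  simp only [InterpolationIneq, hA, hQ, hD]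
  generalize (listPrimitive 0 (listPow trial 2)).sum = A at *
  generalize (listPrimitive 0 (listPow trialDeriv 2)).sum = D at *
  generalize (listPrimitive 0 (listPow trial 4)).sum = Q at *
  obtain ⟨k1, k2⟩ := key
  rw [← Rat.cast_lt (K := ℝ)] at k1 k2
  push_cast at k1 k2
  refine ⟨Q / (A * D), ?_, fun C hC => ?_⟩
  · rwa [lt_div_iff₀ k1]
  · rw [div_le_iff₀ k1]
    linarith

/-! ### The optimal constant -/

theorem interpolationIneq_mono {C C' L : ℝ} {u : ℝ → ℝ} (hL : 0 ≤ L) (hC : C ≤ C')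
    (h : InterpolationIneq C L u) : InterpolationIneq C' L u := by
  unfold InterpolationIneq at h ⊢
  have h1 : 0 ≤ ∫ s in (0 : ℝ)..L, u s ^ 2 :=
    intervalIntegral.integral_nonneg hL fun s _ => sq_nonneg _
  have h2 : 0 ≤ ∫ s in (0 : ℝ)..L, derivWithin u (Icc 0 L) s ^ 2 :=
    intervalIntegral.integral_nonneg hL fun s _ => sq_nonneg _
  exact h.trans (by gcongr)

theorem isNeumannMeanZero_mono {m n : ℕ∞} {L : ℝ} {u : ℝ → ℝ} (hmn : m ≤ n)
    (h : IsNeumannMeanZero n L u) : IsNeumannMeanZero m L u :=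
  ⟨h.contDiffOn.of_le (by exact_mod_cast hmn), h.deriv_left, h.deriv_right, h.mean_zero⟩

theorem interpolationIneq_upper {u : ℝ → ℝ} (hu : IsNeumannMeanZero 1 1 u) :
    InterpolationIneq (0.4028373 ^ 2) 1 u := by
  have := interpolation_unit (by simpa using hu.contDiffOn) hu.mean_zero
  rwa [InterpolationIneq, mul_one]

theorem isLeast_sInf_admissible {P : (ℝ → ℝ) → Prop} {L : ℝ}
    (hne : {C : ℝ | ∀ u, P u → InterpolationIneq C L u}.Nonempty)
    (hbdd : BddBelow {C : ℝ | ∀ u, P u → InterpolationIneq C L u}) :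
    IsLeast {C : ℝ | ∀ u, P u → InterpolationIneq C L u}
      (sInf {C : ℝ | ∀ u, P u → InterpolationIneq C L u}) := by
  refine ⟨IsClosed.csInf_mem ?_ hne hbdd, fun C hC => csInf_le hbdd hC⟩
  simp only [ofPred_forall]
  refine isClosed_iInter fun u => isClosed_iInter fun _ => ?_
  exact isClosed_le continuous_const (by fun_prop)

theorem theorem1p2 :
    (∀ (L : ℝ) (u : ℝ → ℝ), 0 < L → IsNeumannMeanZero 1 L u →
      InterpolationIneq 0.162278 L u) ∧
    ∃ Copt : ℝ, 0.1622778 < Copt ∧ Copt < 0.1622779 ∧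
      ∀ (n : ℕ∞) (L : ℝ), 1 ≤ n → 0 < L →
        IsLeast {C : ℝ | ∀ u : ℝ → ℝ, IsNeumannMeanZero n L u → InterpolationIneq C L u} Copt := by
  obtain ⟨ρ, hρ, hlow⟩ := exists_lower_bound
  set A : Set ℝ := {C : ℝ | ∀ u, IsNeumannMeanZero 1 1 u → InterpolationIneq C 1 u} with hA
  have hmem : 0.4028373 ^ 2 ∈ A := fun u hu => interpolationIneq_upper hu
  have hA_low : ∀ C ∈ A, ρ ≤ C := fun C hC => hlow C (hC _ isNeumannMeanZero_trial)
  have hleast : IsLeast A (sInf A) :=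
    isLeast_sInf_admissible ⟨_, hmem⟩ ⟨ρ, hA_low⟩
  refine ⟨fun L u hL hu => ?_, sInf A, hρ.trans_le (hA_low _ hleast.1), ?_, fun n L hn hL => ?_⟩
  · exact interpolationIneq_mono hL.le (by norm_num)
      (admissible_of_admissible one_pos hL hmem hu)
  · exact (hleast.2 hmem).trans_lt (by norm_num)
  · have e : {C : ℝ | ∀ u, IsNeumannMeanZero n L u → InterpolationIneq C L u} = A := by
      ext C
      refine ⟨fun hC u hu => ?_, fun hC u hu => ?_⟩
      · exact interpolationIneq_of_smooth (fun w hw =>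
          admissible_of_admissible hL one_pos hC (isNeumannMeanZero_mono le_top hw)) hu
      · exact admissible_of_admissible one_pos hL hC (isNeumannMeanZero_mono hn hu)
    rwa [e]
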